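/- Identify $\mathbb R^2$ with $\mathbb C$. Let $\omega$ be a homogeneous Poisson point process of unit intensity on $\mathbb R^2$, realized as a random locally finite set of points. For $s>0$, let $C_\omega([0,s]:\mathbb R^2)$ be the set of piecewise linear paths $\gamma:[0,s]\to\mathbb R^2$ that visit every point of $\omega$ at most once, and define the action of such a path by $$A^s(\gamma)=\frac12\int_0^s|\dot\gamma(u)|^2\,du-\omega_{pp}(\gamma),$$ where $\omega_{pp}(\gamma)$ is the number of points of $\omega$ touched by $\gamma$. For $S\subset\mathbb R^2$ let $$A^s(S)=\inf\{A^s(\gamma):\gamma\in C_\omega([0,s]:\mathbb R^2),\ \gamma(0)=0,\ \gamma(s)\in S\}.$$ For $\gamma'\in\mathbb R$ and $t>0$ put $\theta=t^{-(1-\gamma')}$, $e_1=(1,0)$, $e_2=(0,1)$ and $$S(t)=\Big\{te_1+ae_2: a\in\big[-\tfrac{t^{\gamma'}}2,\tfrac{3t^{\gamma'}}2\big]\Big\},\qquad S'(t)=\Big\{(te_1+ae_2)e^{i\theta}: a\in\big[-\tfrac{3t^{\gamma'}}2,\tfrac{t^{\gamma'}}2\big]\Big\}.$$ **Lemma 4.2.**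 For any $c>0$, any $\gamma'\in\mathbb R$ and any $t_0>0$ there is a constant $C<\infty$ such that for all $t\ge t_0$ the infima $A^{ct}(S(t))$ and $A^{ct}(S'(t))$ are almost surely finite, their difference is square-integrable, and $$\operatorname{Var}\big[A^{ct}(S(t))-A^{ct}(S'(t))\big]\le C\,t^{2(2\gamma'-1)}.$$ -/

import Mathlib

open MeasureTheory ProbabilityTheory Set

/-! The plane `ℝ²` is identified with `ℂ` (Euclidean norm `‖·‖`, Lebesgue measure `volume`).
A point configuration is a subset of the plane; it is locally finite if every bounded set
contains only finitely many of its points. -/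

namespace PoissonFPP

noncomputable section

/-- The number of points of the configuration `ω` in the set `B`
(used only when this number is finite). -/
def count (ω : Set ℂ) (B : Set ℂ) : ℕ := (ω ∩ B).ncard

/-- The random configuration `ω`, defined on the probability space `(Ω, μ)`, is a homogeneous
Poisson point process of unit intensity on the plane. -/
structure IsUnitPoissonProcess {Ω : Type*} [MeasurableSpace Ω] (μ : Measure Ω)
    (ω : Ω → Set ℂ) : Prop where
  /-- Every realization is locally finite. -/
  locallyFinite : ∀ w : Ω, ∀ B : Set ℂ, Bornology.IsBounded B → (ω w ∩ B).Finite
  /-- The number of points in a bounded Borel set is a random variable. -/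
  measurable_count : ∀ B : Set ℂ, MeasurableSet B → Bornology.IsBounded B →
    Measurable fun w => count (ω w) B
  /-- The number of points in `B` is Poisson with mean the area of `B`. -/
  law_count : ∀ B : Set ℂ, MeasurableSet B → Bornology.IsBounded B →
    μ.map (fun w => count (ω w) B) = poissonMeasure (volume B).toNNReal
  /-- The numbers of points in disjoint bounded Borel sets are independent. -/
  indep_count : ∀ (m : ℕ) (B : Fin m → Set ℂ), (∀ i, MeasurableSet (B i)) →
    (∀ i, Bornology.IsBounded (B i)) → Pairwise (fun i j => Disjoint (B i) (B j)) →
    iIndepFun (fun i w => count (ω w) (B i)) μ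

/-- `γ` is piecewise linear on `[0, s]`: there is a partition `0 = τ₀ ≤ τ₁ ≤ … ≤ τₙ = s` such that
`γ` is affine on each closed interval `[τᵢ, τᵢ₊₁]`; in particular `γ` is continuous on `[0, s]`.
Paths are functions on all of `ℝ`, but only their values on `[0, s]` are ever used. -/
def IsPiecewiseLinear (s : ℝ) (γ : ℝ → ℂ) : Prop :=
  ∃ (n : ℕ) (τ : Fin (n + 1) → ℝ), Monotone τ ∧ τ 0 = 0 ∧ τ (Fin.last n) = s ∧
    ∀ i : Fin n, ∃ p v : ℂ, ∀ u ∈ Icc (τ i.castSucc) (τ i.succ), γ u = p + (u : ℂ) * v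

/-- The set `C_ω([0, s] : ℝ²)` of piecewise linear paths on `[0, s]` that visit every point of `ω`
at most once. -/
def admissiblePaths (ω : Set ℂ) (s : ℝ) : Set (ℝ → ℂ) :=
  {γ | IsPiecewiseLinear s γ ∧ ∀ p ∈ ω, {u ∈ Icc 0 s | γ u = p}.Subsingleton}

/-- The action of a path: `½ ∫₀ˢ |γ̇(u)|² du` minus the number of points of `ω` that `γ` touches. -/
def pathAction (ω : Set ℂ) (s : ℝ) (γ : ℝ → ℂ) : ℝ :=
  (1 / 2) * (∫ u in (0 : ℝ)..s, ‖deriv γ u‖ ^ 2) - (count ω (γ '' Icc 0 s) : ℝ)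

/-- The actions of all admissible paths on `[0, s]` that go from `x` to the set `S`. -/
def actionValues (ω : Set ℂ) (s : ℝ) (x : ℂ) (S : Set ℂ) : Set ℝ :=
  pathAction ω s '' {γ ∈ admissiblePaths ω s | γ 0 = x ∧ γ s ∈ S}

/-- The point-to-set action `A^s(x, S)`, the infimum of the actions of the admissible paths. -/
def action (ω : Set ℂ) (s : ℝ) (x : ℂ) (S : Set ℂ) : ℝ :=
  sInf (actionValues ω s x S)

/-- The angle `θ = t^{-(1 - γ')}`. -/
def angle (γ' t : ℝ) : ℝ := t ^ (-(1 - γ'))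

/-- The segment `S(t) = {t e₁ + a e₂ : a ∈ [-t^{γ'}/2, 3 t^{γ'}/2]}`. -/
def segS (γ' t : ℝ) : Set ℂ :=
  (fun a : ℝ => (t : ℂ) + (a : ℂ) * Complex.I) '' Icc (-(t ^ γ') / 2) (3 * t ^ γ' / 2)

/-- The segment `S'(t) = {(t e₁ + a e₂) e^{iθ} : a ∈ [-3 t^{γ'}/2, t^{γ'}/2]}`. -/
def segS' (γ' t : ℝ) : Set ℂ :=
  (fun a : ℝ => ((t : ℂ) + (a : ℂ) * Complex.I) * Complex.exp ((angle γ' t : ℂ) * Complex.I)) ''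
    Icc (-(3 * t ^ γ') / 2) (t ^ γ' / 2)

end

end PoissonFPP

/-!
The action is rewritten as a combinatorial optimization. A path of duration `s` from `0` to `S` that
visits the Poisson points `p₁, …, pₙ` in this order has kinetic action at least `L² / (2 s)`, where
`L = |p₁| + |p₂ - p₁| + … + dist(pₙ, S)`, by Cauchy–Schwarz. Conversely this bound is approached by
paths that run through the chain at nearly constant speed, each leg being replaced by a slight
detour that avoids all other points of the (countable) configuration, so that no point is visited
twice. Hence, as soon as neither `0` nor `S` meets `ω`, which is almost surely the case, the action
is the infimum of `L² / (2 s) - n` over the chains of distinct points of `ω`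
(`action_eq_sInf_chainCost`). This infimum is also seen to be measurable, being determined by the
numbers of points in countably many balls (`aemeasurable_sInf_chainCost`).

The probabilistic input is `exists_length_le`: there are a constant `h > 0` and a square-integrable
`T`, not depending on `t`, with `n ≤ L / h + T` for all chains. It is a first moment bound of
greedy-lattice-animal type. A chain with `L ≤ h n` induces a walk of `n` steps and `ℓ¹`-length at
most `4 n` on the grid of mesh `h`; the walk is occupied, an event of probability at most `h ^ (2 n)`
by independence of the cells; and the number of such walks grows only exponentially at a rate
independent of `h`.

Consequently the kinetic term dominates, nearly optimal chains have length `O(t + T)`, and both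
actions are `O(t + T)`. Let `ϑ = t ^ (γ' - 1)`. For `ϑ ≤ 1` the two segments are within Hausdorff
distance `4 t ϑ²` of each other: the rotation by `ϑ` lifts the segment by about `t ϑ = t ^ γ'`, which
the different ranges of `a` compensate, and only a second-order error remains. Moving the end of a
chain of length `L` by `d` changes its cost by `(2 L d + d²) / (2 c t)`, hence the actions of the two
segments differ by `O(ϑ² (t + T))` (`sInf_chainCost_le_add`). For `ϑ > 1` this bound is
trivial. As `t ϑ² = t ^ (2 γ' - 1)` and `t ≥ t₀`, the second moment of the difference is bounded by a
constant times `t ^ (2 (2 γ' - 1))`.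
-/

namespace PoissonFPP

noncomputable section

open scoped ENNReal NNReal

/-! ### Broken lines -/

/-- `BrokenLine κ γ a c`: on `[a, c]` the path `γ` is a concatenation of finitely many affine
pieces, each of speed at most `κ`. -/
inductive BrokenLine (κ : ℝ) (γ : ℝ → ℂ) : ℝ → ℝ → Prop
  | refl (a : ℝ) : BrokenLine κ γ a a
  | cons {a b c : ℝ} (hab : a ≤ b) (p v : ℂ) (hv : ‖v‖ ≤ κ)
      (h : ∀ u ∈ Icc a b, γ u = p + (u : ℂ) * v) (H : BrokenLine κ γ b c) : BrokenLine κ γ a c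

namespace BrokenLine

variable {κ : ℝ} {γ : ℝ → ℂ} {a c : ℝ}

lemma le (H : BrokenLine κ γ a c) : a ≤ c := by
  induction H with
  | refl => exact le_rfl
  | cons hab _ _ _ _ _ ih => exact hab.trans ih

lemma congr {γ' : ℝ → ℂ} (H : BrokenLine κ γ a c) (h : ∀ u ∈ Icc a c, γ u = γ' u) :
    BrokenLine κ γ' a c := by
  induction H with
  | refl a => exact .refl a
  | cons hab p v hv hγ H ih =>
    have hbc := H.le
    refine .cons hab p v hv (fun u hu => ?_) (ih fun u hu => h u ⟨hab.trans hu.1, hu.2⟩)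
    rw [← h u ⟨hu.1, hu.2.trans hbc⟩, hγ u hu]

lemma mono {κ' : ℝ} (H : BrokenLine κ γ a c) (h : κ ≤ κ') : BrokenLine κ' γ a c := by
  induction H with
  | refl a => exact .refl a
  | cons hab p v hv hγ _ ih => exact .cons hab p v (hv.trans h) hγ ih

lemma exists_partition (H : BrokenLine κ γ a c) :
    ∃ (n : ℕ) (τ : Fin (n + 1) → ℝ), Monotone τ ∧ τ 0 = a ∧ τ (Fin.last n) = c ∧
      ∀ i : Fin n, ∃ p v : ℂ, ∀ u ∈ Icc (τ i.castSucc) (τ i.succ), γ u = p + (u : ℂ) * v := by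
  induction H with
  | refl a => exact ⟨0, fun _ => a, fun _ _ _ => le_rfl, rfl, rfl, fun i => i.elim0⟩
  | @cons a b c hab p v hv hγ H ih =>
    obtain ⟨n, τ, hm, h0, h1, hτ⟩ := ih
    refine ⟨n + 1, Fin.cons a τ, ?_, rfl, ?_, ?_⟩
    · refine Fin.monotone_iff_le_succ.2 fun i => ?_
      refine Fin.cases ?_ (fun j => ?_) i
      · simpa [h0] using hab
      · rw [← Fin.succ_castSucc]
        simpa using hm j.castSucc_le_succ
    · rw [← Fin.succ_last]
      simpa using h1
    · intro i
      refine Fin.cases ?_ (fun j => ?_) i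
      · exact ⟨p, v, by simpa [h0] using hγ⟩
      · rw [← Fin.succ_castSucc]
        simpa using hτ j

lemma isPiecewiseLinear {s : ℝ} (H : BrokenLine κ γ 0 s) : IsPiecewiseLinear s γ :=
  H.exists_partition

lemma of_partition (n : ℕ) (τ : Fin (n + 1) → ℝ) (hm : Monotone τ)
    (h : ∀ i : Fin n, ∃ p v : ℂ, ∀ u ∈ Icc (τ i.castSucc) (τ i.succ), γ u = p + (u : ℂ) * v) :
    ∃ κ, BrokenLine κ γ (τ 0) (τ (Fin.last n)) := by
  induction n with
  | zero => exact ⟨0, .refl _⟩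
  | succ n ih =>
    obtain ⟨κ, H⟩ := ih (fun i => τ i.succ) (fun i j hij => hm (Fin.succ_le_succ_iff.2 hij))
      (fun i => by simpa using h i.succ)
    obtain ⟨p, v, hv⟩ := h 0
    refine ⟨max ‖v‖ κ, .cons (hm (Fin.zero_le _)) p v (le_max_left _ _) hv ?_⟩
    simpa [Fin.succ_last] using H.mono (le_max_right _ _)

lemma continuousOn (H : BrokenLine κ γ a c) : ContinuousOn γ (Icc a c) := by
  induction H with
  | refl a => simp
  | @cons a b c hab p v hv hγ H ih =>
    rw [← Icc_union_Icc_eq_Icc hab H.le]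
    refine ContinuousOn.union_of_isClosed ?_ ih isClosed_Icc isClosed_Icc
    exact ContinuousOn.congr (by fun_prop) hγ

/-- Off the finitely many corners, a broken line is differentiable with speed at most `κ`. -/
lemma exists_finite_hasDerivAt (H : BrokenLine κ γ a c) :
    ∃ F : Set ℝ, F.Finite ∧ ∀ u ∈ Icc a c \ F, DifferentiableAt ℝ γ u ∧ ‖deriv γ u‖ ≤ κ := by
  induction H with
  | refl a => exact ⟨{a}, finite_singleton a, by simp⟩
  | @cons a b c hab p v hv hγ H ih =>
    obtain ⟨F, hF, h⟩ := ih
    refine ⟨insert a (insert b F), (hF.insert _).insert _, fun u hu => ?_⟩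
    simp only [mem_sdiff, mem_insert_iff, not_or] at hu
    obtain ⟨hu, hua, hub, huF⟩ := hu
    rcases le_or_gt u b with hlt | hlt
    · have hd : HasDerivAt γ v u := by
        have h1 : HasDerivAt (fun u : ℝ => p + (u : ℂ) * v) v u := by
          simpa using ((Complex.ofRealCLM.hasDerivAt (x := u)).mul_const v).const_add p
        refine h1.congr_of_eventuallyEq ?_
        filter_upwards [Icc_mem_nhds (lt_of_le_of_ne hu.1 (Ne.symm hua))
          (lt_of_le_of_ne hlt hub)] with x hx using hγ x hx
      exact ⟨hd.differentiableAt, by rwa [hd.deriv]⟩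
    · exact h u ⟨⟨hlt.le, hu.2⟩, huF⟩

lemma ae_norm_deriv_le (H : BrokenLine κ γ a c) :
    ∀ᵐ u ∂volume.restrict (Icc a c), ‖deriv γ u‖ ≤ κ := by
  obtain ⟨F, hF, h⟩ := H.exists_finite_hasDerivAt
  rw [ae_restrict_iff' measurableSet_Icc]
  filter_upwards [hF.countable.ae_notMem volume] with u hu hI using (h u ⟨hI, hu⟩).2

lemma intervalIntegrable_deriv (H : BrokenLine κ γ a c) :
    IntervalIntegrable (deriv γ) volume a c := by
  rw [intervalIntegrable_iff_integrableOn_Icc_of_le H.le]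
  exact Measure.integrableOn_of_bounded (M := κ) (by simp) (measurable_deriv γ).aestronglyMeasurable
    H.ae_norm_deriv_le

lemma intervalIntegrable_sq (H : BrokenLine κ γ a c) :
    IntervalIntegrable (fun u => ‖deriv γ u‖ ^ 2) volume a c := by
  rw [intervalIntegrable_iff_integrableOn_Icc_of_le H.le]
  refine Measure.integrableOn_of_bounded (M := κ ^ 2) (by simp)
    ((measurable_deriv γ).norm.pow_const 2).aestronglyMeasurable ?_
  filter_upwards [H.ae_norm_deriv_le] with u hu
  rw [Real.norm_of_nonneg (by positivity)]
  gcongr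

lemma integral_sq_le (H : BrokenLine κ γ a c) :
    ∫ u in a..c, ‖deriv γ u‖ ^ 2 ≤ κ ^ 2 * (c - a) := by
  calc ∫ u in a..c, ‖deriv γ u‖ ^ 2 ≤ ∫ _ in a..c, κ ^ 2 := by
        refine intervalIntegral.integral_mono_ae_restrict H.le H.intervalIntegrable_sq
          (by simp) ?_
        filter_upwards [H.ae_norm_deriv_le] with u hu
        gcongr
    _ = κ ^ 2 * (c - a) := by simp [mul_comm]

lemma dist_le_integral (H : BrokenLine κ γ a c) {x y : ℝ} (hax : a ≤ x) (hxy : x ≤ y)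
    (hyc : y ≤ c) : dist (γ x) (γ y) ≤ ∫ u in x..y, ‖deriv γ u‖ := by
  obtain ⟨F, hF, h⟩ := H.exists_finite_hasDerivAt
  have hsub : Icc x y ⊆ Icc a c := Icc_subset_Icc hax hyc
  have hint : IntervalIntegrable (deriv γ) volume x y :=
    H.intervalIntegrable_deriv.mono_set (by rwa [uIcc_of_le hxy, uIcc_of_le H.le])
  have := integral_eq_of_hasDerivAt_off_countable_of_le γ (deriv γ) hxy hF.countable
    (H.continuousOn.mono hsub)
    (fun u hu => (h u ⟨hsub (Ioo_subset_Icc_self hu.1), hu.2⟩).1.hasDerivAt) hint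
  rw [dist_comm, dist_eq_norm, ← this]
  exact intervalIntegral.norm_integral_le_integral_norm hxy

/-- Cauchy–Schwarz: length squared is at most duration times twice the kinetic action. -/
lemma sq_integral_le (H : BrokenLine κ γ a c) :
    (∫ u in a..c, ‖deriv γ u‖) ^ 2 ≤ (c - a) * ∫ u in a..c, ‖deriv γ u‖ ^ 2 := by
  rcases H.le.eq_or_lt with rfl | hac
  · simp
  set I := ∫ u in a..c, ‖deriv γ u‖ with hI
  set J := ∫ u in a..c, ‖deriv γ u‖ ^ 2 with hJ
  have h1 := H.intervalIntegrable_deriv.norm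
  have h2 := H.intervalIntegrable_sq
  set m := I / (c - a) with hm
  have hpos : 0 ≤ ∫ u in a..c, (‖deriv γ u‖ - m) ^ 2 :=
    intervalIntegral.integral_nonneg hac.le fun u _ => sq_nonneg _
  have heq : ∫ u in a..c, (‖deriv γ u‖ - m) ^ 2 = J - 2 * m * I + m ^ 2 * (c - a) := by
    have : (fun u => (‖deriv γ u‖ - m) ^ 2) =
        fun u => (‖deriv γ u‖ ^ 2 - (2 * m) * ‖deriv γ u‖) + m ^ 2 := by
      funext u; ring
    rw [this, intervalIntegral.integral_add (h2.sub (h1.const_mul _)) (by simp),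
      intervalIntegral.integral_sub h2 (h1.const_mul _), intervalIntegral.integral_const_mul]
    simp [mul_comm, hI, hJ]
  have hca : 0 < c - a := sub_pos.2 hac
  have hIm : I = m * (c - a) := by rw [hm]; field_simp
  rw [heq, hIm] at hpos
  rw [hIm]
  nlinarith

end BrokenLine

lemma IsPiecewiseLinear.exists_brokenLine {s : ℝ} {γ : ℝ → ℂ} (h : IsPiecewiseLinear s γ) :
    ∃ κ, BrokenLine κ γ 0 s := by
  obtain ⟨n, τ, hm, h0, h1, hτ⟩ := h
  simpa [h0, h1] using BrokenLine.of_partition n τ hm hτ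

/-! ### Chains of points -/

/-- The length of the shortest path that starts at `a`, runs through the points of the list `l`
in order, and ends in `S`. With `S = univ` the last leg has length `0`. -/
def chainLength (S : Set ℂ) : ℂ → List ℂ → ℝ
  | a, [] => Metric.infDist a S
  | a, p :: l => dist a p + chainLength S p l

/-- A chain of `ω` is a finite sequence of distinct points of `ω`. -/
def IsChainOf (ω : Set ℂ) (l : List ℂ) : Prop := l.Nodup ∧ ∀ p ∈ l, p ∈ ω

/-- The least action, for duration `s`, of a path from `0` to `S` that runs through the points of
`l` in order and collects these points only: it is traversed at constant speed. -/
def chainCost (S : Set ℂ) (s : ℝ) (l : List ℂ) : ℝ :=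
  chainLength S 0 l ^ 2 / (2 * s) - l.length

lemma chainLength_nonneg (S : Set ℂ) (a : ℂ) (l : List ℂ) : 0 ≤ chainLength S a l := by
  induction l generalizing a with
  | nil => exact Metric.infDist_nonneg
  | cons p l ih => exact add_nonneg dist_nonneg (ih p)

lemma exists_chainLength_singleton_lt {S : Set ℂ} (hS : S.Nonempty) (a : ℂ) (l : List ℂ) {r : ℝ}
    (h : chainLength S a l < r) : ∃ x ∈ S, chainLength {x} a l < r := by
  induction l generalizing a r with
  | nil => simpa [chainLength] using (Metric.infDist_lt_iff hS).1 h
  | cons p l ih =>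
    obtain ⟨x, hx, h'⟩ := ih p (r := r - dist a p) (by simp only [chainLength] at h; linarith)
    exact ⟨x, hx, by simp only [chainLength]; linarith⟩

/-! ### Every path costs at least as much as the chain it visits -/

/-- A broken line ending in `S` is at least as long as the chain of its positions at any increasing
sequence of times. -/
lemma BrokenLine.chainLength_le {κ : ℝ} {γ : ℝ → ℂ} {c : ℝ} {S : Set ℂ} (hS : γ c ∈ S)
    (l : List ℝ) {a : ℝ} (H : BrokenLine κ γ a c) {b : ℝ} (hab : a ≤ b) (hbc : b ≤ c)
    (hl : l.SortedLE) (hmem : ∀ u ∈ l, u ∈ Icc b c) :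
    chainLength S (γ b) (l.map γ) ≤ ∫ u in b..c, ‖deriv γ u‖ := by
  induction l generalizing b with
  | nil => exact (Metric.infDist_le_dist_of_mem hS).trans (H.dist_le_integral hab hbc le_rfl)
  | cons u l ih =>
    have hu := hmem u (by simp)
    have hl' := List.pairwise_cons.1 hl.pairwise
    have h1 := ih (hab.trans hu.1) hu.2 hl'.2.sortedLE
      fun v hv => ⟨hl'.1 v hv, (hmem v (by simp [hv])).2⟩
    have h2 := H.dist_le_integral hab hu.1 hu.2
    have hi : ∀ x y, a ≤ x → x ≤ y → y ≤ c →
        IntervalIntegrable (fun u => ‖deriv γ u‖) volume x y := fun x y hx hxy hy =>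
      H.intervalIntegrable_deriv.norm.mono_set (by
        rw [uIcc_of_le hxy, uIcc_of_le H.le]; exact Icc_subset_Icc hx hy)
    rw [← intervalIntegral.integral_add_adjacent_intervals (hi b u hab hu.1 hu.2)
      (hi u c (hab.trans hu.1) hu.2 le_rfl)]
    exact add_le_add h2 h1

lemma exists_chainCost_le {ω : Set ℂ} (hω : ∀ B, Bornology.IsBounded B → (ω ∩ B).Finite)
    {s : ℝ} (hs : 0 < s) {S : Set ℂ} {v : ℝ} (hv : v ∈ actionValues ω s 0 S) :
    ∃ l, IsChainOf ω l ∧ chainCost S s l ≤ v := by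
  obtain ⟨γ, ⟨⟨hpl, hsub⟩, h0, hγS⟩, rfl⟩ := hv
  obtain ⟨κ, H⟩ := hpl.exists_brokenLine
  have hbdd : Bornology.IsBounded (γ '' Icc 0 s) :=
    (isCompact_Icc.image_of_continuousOn H.continuousOn).isBounded
  have hfin := hω _ hbdd
  set U : Set ℝ := {u ∈ Icc 0 s | γ u ∈ ω} with hU
  have hinj : InjOn γ U := fun u hu v hv huv => hsub (γ v) hv.2 ⟨hu.1, huv⟩ ⟨hv.1, rfl⟩
  have himg : γ '' U = ω ∩ γ '' Icc 0 s := by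
    ext p; constructor
    · rintro ⟨u, hu, rfl⟩; exact ⟨hu.2, u, hu.1, rfl⟩
    · rintro ⟨hp, u, hu, rfl⟩; exact ⟨u, ⟨hu, hp⟩, rfl⟩
  have hUfin : U.Finite := Finite.of_finite_image (by rwa [himg]) hinj
  set L := hUfin.toFinset.sort (· ≤ ·) with hL
  have hmem : ∀ u, u ∈ L ↔ u ∈ U := by simp [hL]
  refine ⟨L.map γ, ⟨?_, ?_⟩, ?_⟩
  · exact (List.nodup_map_iff_inj_on (Finset.sort_nodup _ _)).2
      fun x hx y hy hxy => hinj ((hmem x).1 hx) ((hmem y).1 hy) hxy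
  · intro p hp
    obtain ⟨u, hu, rfl⟩ := List.mem_map.1 hp
    exact ((hmem u).1 hu).2
  · have hcount : count ω (γ '' Icc 0 s) = L.length := by
      rw [count, ← himg, hinj.ncard_image, ncard_eq_toFinset_card _ hUfin, hL,
        Finset.length_sort]
    have hlen := H.chainLength_le hγS L le_rfl hs.le (Finset.sortedLT_sort _).sortedLE
      fun u hu => ((hmem u).1 hu).1
    rw [h0] at hlen
    have hsq := (pow_le_pow_left₀ (chainLength_nonneg _ _ _) hlen 2).trans H.sq_integral_le
    rw [chainCost, pathAction, hcount, List.length_map]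
    gcongr
    rw [div_le_iff₀ (by positivity)]
    nlinarith

/-! ### Every chain is visited by an admissible path of almost the same cost -/

/-- Two points are joined by a broken line that is hardly longer than their distance and that
avoids a given countable set, the two points excepted: among the isosceles detours through
`(a + b) / 2 + i x (b - a)` only countably many `x` are bad. -/
lemma exists_brokenLine_avoiding {ω : Set ℂ} (hω : ω.Countable) {a b : ℂ} (hab : a ≠ b)
    {κ T₀ T₁ : ℝ} (hκ : 0 < κ) (h : dist a b < κ * (T₁ - T₀)) :
    ∃ γ : ℝ → ℂ, ∃ m v w p q, T₀ < m ∧ m < T₁ ∧ ‖v‖ ≤ κ ∧ ‖w‖ ≤ κ ∧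
      (∀ u ∈ Icc T₀ m, γ u = p + (u : ℂ) * v) ∧ (∀ u ∈ Icc m T₁, γ u = q + (u : ℂ) * w) ∧
      γ T₀ = a ∧ γ T₁ = b ∧ ∀ u ∈ Ioo T₀ T₁, γ u ∉ ω := by
  have hT : 0 < T₁ - T₀ := by
    have := dist_nonneg (x := a) (y := b)
    by_contra! hc
    nlinarith
  have hd : b - a ≠ 0 := sub_ne_zero.2 hab.symm
  have hd' : 0 < ‖b - a‖ := norm_pos_iff.2 hd
  set f : ℂ → ℂ := fun z => (z - a) / (b - a)
  -- in the coordinate `f`, which sends `a` to `0` and `b` to `1`, a point of either leg of the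
  -- detour determines `x`
  set bad : Set ℝ := (fun z => (f z).im / (2 * (f z).re)) '' ω ∪
    (fun z => (f z).im / (2 * (1 - (f z).re))) '' ω with hbad
  have hbadc : bad.Countable := (hω.image _).union (hω.image _)
  obtain ⟨δ, hδ, hδκ⟩ : ∃ δ : ℝ, 0 < δ ∧ ‖b - a‖ * (1 + 2 * δ) ≤ κ * (T₁ - T₀) := by
    rw [dist_comm, dist_eq_norm] at h
    refine ⟨(κ * (T₁ - T₀) - ‖b - a‖) / (2 * ‖b - a‖), by apply div_pos <;> linarith, ?_⟩
    apply le_of_eq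
    field_simp
    ring
  obtain ⟨x, hx, hxbad⟩ : ∃ x ∈ Ioo 0 δ, x ∉ bad := by
    by_contra! hc
    exact (Cardinal.Real.Ioo_countable_iff.1 (hbadc.mono hc)).not_gt hδ
  have hnorm : ∀ e : ℂ, ‖e‖ ≤ 1 / 2 + x → ‖2 / ((T₁ - T₀ : ℝ) : ℂ) * e * (b - a)‖ ≤ κ := by
    intro e he
    rw [norm_mul, norm_mul, norm_div, Complex.norm_real, Real.norm_of_nonneg hT.le,
      Complex.norm_ofNat]
    rw [div_mul_eq_mul_div, div_mul_eq_mul_div, div_le_iff₀ hT]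
    nlinarith [hx.2, mul_le_mul_of_nonneg_left he hd'.le, mul_lt_mul_of_pos_left hx.2 hd']
  have htri : ∀ y : ℝ, |y| = 1 / 2 → ‖(y : ℂ) + x * Complex.I‖ ≤ 1 / 2 + x := by
    intro y hy
    refine (norm_add_le _ _).trans ?_
    simp [hy, abs_of_pos hx.1]
  set v := 2 / ((T₁ - T₀ : ℝ) : ℂ) * (((1 / 2 : ℝ) : ℂ) + x * Complex.I) * (b - a) with hv
  set w := 2 / ((T₁ - T₀ : ℝ) : ℂ) * (((1 / 2 : ℝ) : ℂ) - x * Complex.I) * (b - a) with hw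
  have hTc : ((T₁ - T₀ : ℝ) : ℂ) ≠ 0 := by exact_mod_cast hT.ne'
  set m := (T₀ + T₁) / 2 with hm
  have hvw : a + ((m - T₀ : ℝ) : ℂ) * v = b + ((m - T₁ : ℝ) : ℂ) * w := by
    have h1 : m - T₀ = (T₁ - T₀) / 2 := by rw [hm]; ring
    have h2 : m - T₁ = -((T₁ - T₀) / 2) := by rw [hm]; ring
    rw [h1, h2, hv, hw]
    push_cast at hTc ⊢
    field_simp
    ring
  set γ : ℝ → ℂ := fun u =>
    if u ≤ m then a + ((u - T₀ : ℝ) : ℂ) * v else b + ((u - T₁ : ℝ) : ℂ) * w with hγ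
  have hfst : ∀ u ∈ Icc T₀ m, γ u = a + ((u - T₀ : ℝ) : ℂ) * v :=
    fun u hu => if_pos hu.2
  have hsnd : ∀ u ∈ Icc m T₁, γ u = b + ((u - T₁ : ℝ) : ℂ) * w := by
    intro u hu
    rcases hu.1.eq_or_lt with rfl | hlt
    · rw [← hvw]; exact if_pos le_rfl
    · exact if_neg hlt.not_ge
  refine ⟨γ, m, v, w, a - T₀ * v, b - T₁ * w, by linarith, by linarith, hnorm _ (htri _ (by norm_num)), ?_,
    ?_, ?_, ?_, ?_, ?_⟩
  · refine hnorm _ ?_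
    have := htri (-(1 / 2)) (by norm_num)
    rwa [← norm_neg, show -(((1 / 2 : ℝ) : ℂ) - x * Complex.I) =
      ((-(1 / 2) : ℝ) : ℂ) + x * Complex.I by push_cast; ring]
  · intro u hu
    refine (hfst u hu).trans ?_
    push_cast; ring
  · intro u hu
    refine (hsnd u hu).trans ?_
    push_cast; ring
  · refine (hfst T₀ ⟨le_rfl, by linarith⟩).trans ?_
    simp
  · refine (hsnd T₁ ⟨by linarith, le_rfl⟩).trans ?_
    simp
  · intro u hu hmem
    apply hxbad
    rcases le_or_gt u m with hum | hum
    · rw [hfst u ⟨hu.1.le, hum⟩] at hmem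
      refine Or.inl ⟨_, hmem, ?_⟩
      have hf : f (a + ((u - T₀ : ℝ) : ℂ) * v) =
          ((2 * (u - T₀) / (T₁ - T₀) : ℝ) : ℂ) * (((1 / 2 : ℝ) : ℂ) + x * Complex.I) := by
        simp only [f, hv, add_sub_cancel_left]
        push_cast at hTc ⊢
        field_simp
      have hp : 0 < u - T₀ := sub_pos.2 hu.1
      simp only [hf, Complex.re_ofReal_mul, Complex.im_ofReal_mul]
      simp
      field_simp
    · rw [hsnd u ⟨hum.le, hu.2.le⟩] at hmem
      refine Or.inr ⟨_, hmem, ?_⟩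
      have hf : f (b + ((u - T₁ : ℝ) : ℂ) * w) =
          1 + ((2 * (u - T₁) / (T₁ - T₀) : ℝ) : ℂ) * (((1 / 2 : ℝ) : ℂ) - x * Complex.I) := by
        simp only [f, hw]
        push_cast at hTc ⊢
        field_simp
        ring
      have hp : u - T₁ ≠ 0 := (sub_neg.2 hu.2).ne
      simp only [hf, Complex.add_re, Complex.add_im, Complex.re_ofReal_mul, Complex.im_ofReal_mul]
      simp
      field_simp

/-- A chain is visited by a broken line from `a` to `x` of speed at most `κ`, as soon as the time
suffices to run through the chain at a speed less than `κ`. The broken line touches no points of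
`ω` but those of the chain (and `a`), and none of them twice. -/
lemma exists_brokenLine_through {ω : Set ℂ} (hω : ω.Countable) {κ : ℝ} (hκ : 0 < κ) {x : ℂ}
    (hx : x ∉ ω) (l : List ℂ) {a : ℂ} (hal : (a :: l).Nodup) (hl : ∀ p ∈ l, p ∈ ω) (hax : a ≠ x)
    {T₀ T₁ : ℝ} (h : chainLength {x} a l < κ * (T₁ - T₀)) :
    ∃ γ : ℝ → ℂ, BrokenLine κ γ T₀ T₁ ∧ γ T₀ = a ∧ γ T₁ = x ∧
      (∀ u ∈ Icc T₀ T₁, γ u ∈ ω → γ u ∈ a :: l) ∧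
      (∀ p ∈ ω, {u ∈ Icc T₀ T₁ | γ u = p}.Subsingleton) ∧
      ∀ p ∈ l, ∃ u ∈ Icc T₀ T₁, γ u = p := by
  induction l generalizing a T₀ with
  | nil =>
    obtain ⟨γ, m, v, w, p, q, h0m, hm1, hv, hw, hγv, hγw, h0, h1, hav⟩ :=
      exists_brokenLine_avoiding hω hax hκ (by simpa [chainLength] using h)
    have key : ∀ u ∈ Icc T₀ T₁, γ u ∈ ω → u = T₀ := by
      intro u hu hmem
      by_contra hne
      rcases hu.2.eq_or_lt with rfl | hlt
      · exact hx (h1 ▸ hmem)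
      · exact hav u ⟨lt_of_le_of_ne hu.1 (Ne.symm hne), hlt⟩ hmem
    refine ⟨γ, .cons h0m.le p v hv hγv (.cons hm1.le q w hw hγw (.refl _)), h0, h1, ?_, ?_,
      by simp⟩
    · intro u hu hmem
      simp [key u hu hmem, h0]
    · rintro p hp u ⟨hu, rfl⟩ u' ⟨hu', he⟩
      rw [key u hu hp, key u' hu' (he ▸ hp)]
  | cons b l ih =>
    have hab : a ≠ b := by rintro rfl; simp at hal
    have hbω := hl b (by simp)
    have hbx : b ≠ x := by rintro rfl; exact hx hbω
    -- divide the spare time evenly between the first leg and the rest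
    obtain ⟨T, hT0, hT1⟩ : ∃ T, dist a b < κ * (T - T₀) ∧ chainLength {x} b l < κ * (T₁ - T) := by
      simp only [chainLength] at h
      set e := κ * (T₁ - T₀) - dist a b - chainLength {x} b l with he
      have h2 : κ * ((dist a b + e / 2) / κ) = dist a b + e / 2 := by field_simp
      refine ⟨T₀ + (dist a b + e / 2) / κ, ?_, ?_⟩
      · rw [add_sub_cancel_left, h2]; linarith
      · rw [← sub_sub, mul_sub, h2]; linarith
    obtain ⟨α, m, v, w, p, q, h0m, hm1, hv, hw, hαv, hαw, h0, h1, hav⟩ :=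
      exists_brokenLine_avoiding hω hab hκ hT0
    obtain ⟨β, H, hβ0, hβ1, hβω, hβs, hβl⟩ := ih (List.nodup_cons.1 hal).2
      (fun p hp => hl p (by simp [hp])) hbx hT1
    set γ : ℝ → ℂ := fun u => if u < T then α u else β u with hγ
    have hγα : ∀ u ∈ Icc T₀ T, γ u = α u := by
      intro u hu
      rcases hu.2.eq_or_lt with rfl | hlt
      · rw [h1, ← hβ0]; exact if_neg (lt_irrefl _)
      · exact if_pos hlt
    have hγβ : ∀ u ∈ Icc T T₁, γ u = β u := fun u hu => if_neg hu.1.not_gt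
    have hTT := H.le
    have h0T : T₀ < T := h0m.trans hm1
    have hfst : ∀ u ∈ Ico T₀ T, γ u ∈ ω → u = T₀ := by
      intro u hu hmem
      by_contra hne
      rw [hγα u ⟨hu.1, hu.2.le⟩] at hmem
      exact hav u ⟨lt_of_le_of_ne hu.1 (Ne.symm hne), hu.2⟩ hmem
    have hγ0 : γ T₀ = a := by rw [hγα T₀ ⟨le_rfl, h0T.le⟩, h0]
    refine ⟨γ, ?_, hγ0, by rw [hγβ T₁ ⟨hTT, le_rfl⟩, hβ1], ?_, ?_, ?_⟩
    · refine .cons h0m.le p v hv (fun u hu => ?_) (.cons hm1.le q w hw (fun u hu => ?_)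
        (H.congr fun u hu => (hγβ u hu).symm))
      · rw [hγα u ⟨hu.1, hu.2.trans hm1.le⟩, hαv u hu]
      · rw [hγα u ⟨h0m.le.trans hu.1, hu.2⟩, hαw u hu]
    · intro u hu hmem
      rcases lt_or_ge u T with hlt | hge
      · rw [hfst u ⟨hu.1, hlt⟩ hmem, hγ0]; simp
      · rw [hγβ u ⟨hge, hu.2⟩] at hmem ⊢
        exact List.mem_cons_of_mem _ (hβω u ⟨hge, hu.2⟩ hmem)
    · -- a point met before time `T` can only be `a`, which is not met afterwards
      have hne : ∀ u ∈ Ico T₀ T, ∀ u' ∈ Icc T T₁, γ u ∈ ω → γ u ≠ γ u' := by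
        intro u hu u' hu' hmem he
        have hmem' := he ▸ hmem
        rw [hfst u hu hmem, hγ0] at he
        rw [hγβ u' hu'] at he hmem'
        exact (List.nodup_cons.1 hal).1 (he ▸ hβω u' hu' hmem')
      rintro p hp u ⟨hu, rfl⟩ u' ⟨hu', he⟩
      rcases lt_or_ge u T with hlt | hge <;> rcases lt_or_ge u' T with hlt' | hge'
      · rw [hfst u ⟨hu.1, hlt⟩ hp, hfst u' ⟨hu'.1, hlt'⟩ (he ▸ hp)]
      · exact absurd he.symm (hne u ⟨hu.1, hlt⟩ u' ⟨hge', hu'.2⟩ hp)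
      · exact absurd he (hne u' ⟨hu'.1, hlt'⟩ u ⟨hge, hu.2⟩ (he ▸ hp))
      · refine hβs _ hp ⟨⟨hge, hu.2⟩, (hγβ u ⟨hge, hu.2⟩).symm⟩ ⟨⟨hge', hu'.2⟩, ?_⟩
        rw [← hγβ u' ⟨hge', hu'.2⟩, he]
    · intro p hp
      rcases List.mem_cons.1 hp with rfl | hp
      · exact ⟨T, ⟨h0T.le, hTT⟩, by rw [hγβ T ⟨le_rfl, hTT⟩, hβ0]⟩
      · obtain ⟨u, hu, rfl⟩ := hβl p hp
        exact ⟨u, ⟨h0T.le.trans hu.1, hu.2⟩, hγβ u hu⟩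

lemma exists_actionValue_lt {ω : Set ℂ} (hω : ∀ B, Bornology.IsBounded B → (ω ∩ B).Finite)
    (h0 : (0 : ℂ) ∉ ω) {S : Set ℂ} (hS : S.Nonempty) (hSω : Disjoint S ω) (h0S : (0 : ℂ) ∉ S)
    {s : ℝ} (hs : 0 < s) {l : List ℂ} (hl : IsChainOf ω l) {r : ℝ} (hr : chainCost S s l < r) :
    ∃ v ∈ actionValues ω s 0 S, v < r := by
  have hωc : ω.Countable := by
    rw [← inter_univ ω, ← Metric.iUnion_closedBall_nat (0 : ℂ), inter_iUnion]
    exact countable_iUnion fun n => (hω _ Metric.isBounded_closedBall).countable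
  obtain ⟨κ, hκ, hκ0, hκr⟩ : ∃ κ : ℝ, chainLength S 0 l < s * κ ∧ 0 < κ ∧
      κ ^ 2 * s / 2 - l.length < r := by
    set k := chainLength S 0 l / s with hk
    have hk0 : 0 ≤ k := div_nonneg (chainLength_nonneg _ _ _) hs.le
    have hlim : Filter.Tendsto (fun κ : ℝ => κ ^ 2 * s / 2 - l.length) (nhdsWithin k (Ioi k))
        (nhds (k ^ 2 * s / 2 - l.length)) :=
      (Continuous.tendsto (by fun_prop) k).mono_left nhdsWithin_le_nhds
    have hcost : k ^ 2 * s / 2 - l.length < r := by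
      convert hr using 2
      rw [chainCost, hk]; field_simp
    obtain ⟨κ, hκ1, hκ2⟩ := ((hlim.eventually_lt_const hcost).and self_mem_nhdsWithin).exists
    have hκ2 : k < κ := hκ2
    refine ⟨κ, ?_, hk0.trans_lt hκ2, hκ1⟩
    rwa [hk, div_lt_iff₀' hs] at hκ2
  obtain ⟨x, hxS, hx⟩ := exists_chainLength_singleton_lt hS 0 l hκ
  have h0l : (0 : ℂ) ∉ l := fun h => h0 (hl.2 _ h)
  obtain ⟨γ, H, hγ0, hγ1, -, hγs, hγl⟩ := exists_brokenLine_through (T₀ := 0) (T₁ := s) hωc hκ0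
    (disjoint_left.1 hSω hxS) l (List.nodup_cons.2 ⟨h0l, hl.1⟩) hl.2
    (fun h => h0S (h ▸ hxS)) (by simpa [mul_comm] using hx)
  refine ⟨_, ⟨γ, ⟨⟨H.isPiecewiseLinear, hγs⟩, hγ0, hγ1 ▸ hxS⟩, rfl⟩, lt_of_le_of_lt ?_ hκr⟩
  have hcard : l.length ≤ count ω (γ '' Icc 0 s) := by
    rw [← List.toFinset_card_of_nodup hl.1, ← ncard_coe_finset]
    refine ncard_le_ncard (fun p hp => ?_)
      (hω _ (isCompact_Icc.image_of_continuousOn H.continuousOn).isBounded)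
    have hp : p ∈ l := by simpa using hp
    exact ⟨hl.2 p hp, hγl p hp⟩
  have hint := H.integral_sq_le
  have hcard' : (l.length : ℝ) ≤ count ω (γ '' Icc 0 s) := by exact_mod_cast hcard
  rw [pathAction]
  rw [sub_zero] at hint
  linarith

/-- If neither `0` nor `S` meets `ω`, the action is an infimum over chains. -/
theorem action_eq_sInf_chainCost {ω : Set ℂ}
    (hω : ∀ B, Bornology.IsBounded B → (ω ∩ B).Finite) (h0 : (0 : ℂ) ∉ ω) {S : Set ℂ}
    (hS : S.Nonempty) (hSω : Disjoint S ω) (h0S : (0 : ℂ) ∉ S) {s : ℝ} (hs : 0 < s)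
    (hbdd : BddBelow (chainCost S s '' {l | IsChainOf ω l})) :
    BddBelow (actionValues ω s 0 S) ∧
      action ω s 0 S = sInf (chainCost S s '' {l | IsChainOf ω l}) := by
  obtain ⟨b, hb⟩ := hbdd
  have hlow : ∀ v ∈ actionValues ω s 0 S,
      ∃ l ∈ {l | IsChainOf ω l}, chainCost S s l ≤ v := fun v hv => exists_chainCost_le hω hs hv
  have hup : ∀ l, IsChainOf ω l → ∀ r, chainCost S s l < r →
      ∃ v ∈ actionValues ω s 0 S, v < r := fun l hl r hr =>
    exists_actionValue_lt hω h0 hS hSω h0S hs hl hr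
  have hnil : IsChainOf ω [] := ⟨List.nodup_nil, by simp⟩
  have hbdd' : BddBelow (actionValues ω s 0 S) := ⟨b, fun v hv => by
    obtain ⟨l, hl, hle⟩ := hlow v hv
    exact (hb ⟨l, hl, rfl⟩).trans hle⟩
  refine ⟨hbdd', le_antisymm ?_ ?_⟩
  · refine le_csInf ⟨_, [], hnil, rfl⟩ ?_
    rintro _ ⟨l, hl, rfl⟩
    refine le_of_forall_gt fun r hr => ?_
    obtain ⟨v, hv, hvr⟩ := hup l hl r hr
    exact (csInf_le hbdd' hv).trans_lt hvr
  · obtain ⟨v, hv, -⟩ := hup [] hnil _ (lt_add_one _)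
    refine le_csInf ⟨v, hv⟩ fun v hv => ?_
    obtain ⟨l, hl, hle⟩ := hlow v hv
    exact (csInf_le ⟨b, hb⟩ ⟨l, hl, rfl⟩).trans hle

/-! ### The square grid -/

/-- The index of the cell of the grid `(h ℤ)²` that contains `z`. -/
def cellIndex (h : ℝ) (z : ℂ) : ℤ × ℤ := (⌊z.re / h⌋, ⌊z.im / h⌋)

/-- The half-open cells of the grid `(h ℤ)²`. -/
def cell (h : ℝ) (i : ℤ × ℤ) : Set ℂ := cellIndex h ⁻¹' {i}

lemma cell_eq {h : ℝ} (hh : 0 < h) (i : ℤ × ℤ) :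
    cell h i = Ico (i.1 * h) ((i.1 + 1) * h) ×ℂ Ico (i.2 * h) ((i.2 + 1) * h) := by
  ext z
  simp only [cell, cellIndex, mem_preimage, mem_singleton_iff, Prod.ext_iff, Complex.mem_reProdIm,
    Int.floor_eq_iff, mem_Ico, le_div_iff₀ hh, div_lt_iff₀ hh]

lemma isBounded_cell {h : ℝ} (hh : 0 < h) (i : ℤ × ℤ) : Bornology.IsBounded (cell h i) := by
  rw [cell_eq hh]
  exact (Metric.isBounded_Ico _ _).reProdIm (Metric.isBounded_Ico _ _)

lemma measurableSet_cell (h : ℝ) (i : ℤ × ℤ) : MeasurableSet (cell h i) := by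
  have : Measurable (cellIndex h) := by unfold cellIndex; fun_prop
  exact this (measurableSet_singleton i)

lemma disjoint_cell (h : ℝ) {i j : ℤ × ℤ} (hij : i ≠ j) : Disjoint (cell h i) (cell h j) :=
  Disjoint.preimage _ (disjoint_singleton.2 hij)

lemma volume_cell {h : ℝ} (hh : 0 < h) (i : ℤ × ℤ) :
    volume (cell h i) = ENNReal.ofReal (h ^ 2) := by
  have : cell h i = Complex.measurableEquivRealProd ⁻¹'
      (Ico (i.1 * h) ((i.1 + 1) * h) ×ˢ Ico (i.2 * h) ((i.2 + 1) * h)) := by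
    rw [cell_eq hh]; ext z; simp [Complex.mem_reProdIm]
  rw [this, Complex.volume_preserving_equiv_real_prod.measure_preimage_equiv, Measure.volume_eq_prod,
    Measure.prod_prod, Real.volume_Ico, Real.volume_Ico, ← ENNReal.ofReal_mul (by nlinarith)]
  congr 1; ring

/-! ### Weighted walks on the grid -/

/-- The weight of a step of a walk on `ℤ²`, exponentially small in its `ℓ¹`-length. -/
def stepWeight (i j : ℤ × ℤ) : ℝ≥0∞ :=
  ENNReal.ofReal (Real.exp (-(|(j.1 - i.1 : ℤ)| + |(j.2 - i.2 : ℤ)| : ℤ)))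

/-- The weight of the walk from `i` through the sites of the list: the product of the weights of
its steps. -/
def walkWeight : ℤ × ℤ → List (ℤ × ℤ) → ℝ≥0∞
  | _, [] => 1
  | i, j :: c => stepWeight i j * walkWeight j c

/-- The total weight of all steps from a site. -/
def totalWeight : ℝ≥0∞ := ∑' j, stepWeight 0 j

lemma totalWeight_ne_top : totalWeight ≠ ⊤ := by
  have hsum : Summable fun n : ℤ => Real.exp (-(|n| : ℤ)) := by
    have h1 : Summable fun n : ℕ => Real.exp (-(n : ℝ)) := Real.summable_exp_neg_nat
    refine Summable.of_nat_of_neg ?_ ?_ <;> simpa using h1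
  have h : ∀ j, stepWeight 0 j =
      ENNReal.ofReal (Real.exp (-(|j.1| : ℤ))) * ENNReal.ofReal (Real.exp (-(|j.2| : ℤ))) := by
    intro j
    rw [← ENNReal.ofReal_mul (Real.exp_pos _).le, ← Real.exp_add, stepWeight]
    congr 2
    push_cast
    simp
    ring
  rw [totalWeight]
  simp_rw [h]
  rw [ENNReal.tsum_prod (f := fun a b : ℤ =>
    ENNReal.ofReal (Real.exp (-(|a| : ℤ))) * ENNReal.ofReal (Real.exp (-(|b| : ℤ))))]
  simp_rw [ENNReal.tsum_mul_left, ENNReal.tsum_mul_right]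
  have := hsum.tsum_ofReal_ne_top
  exact ENNReal.mul_ne_top this this

lemma tsum_stepWeight (i : ℤ × ℤ) : ∑' j, stepWeight i j = totalWeight := by
  rw [totalWeight, ← (Equiv.subRight i).tsum_eq (stepWeight 0)]
  simp [stepWeight]

lemma tsum_walkWeight (n : ℕ) (i : ℤ × ℤ) :
    ∑' c : List.Vector (ℤ × ℤ) n, walkWeight i c.toList = totalWeight ^ n := by
  induction n generalizing i with
  | zero =>
    rw [tsum_eq_single List.Vector.nil fun c hc => absurd (Subsingleton.elim c _) hc]
    simp [walkWeight]
  | succ n ih =>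
    let e : (ℤ × ℤ) × List.Vector (ℤ × ℤ) n ≃ List.Vector (ℤ × ℤ) (n + 1) :=
      { toFun := fun p => p.1 ::ᵥ p.2
        invFun := fun v => (v.head, v.tail)
        left_inv := fun p => by simp
        right_inv := fun v => by simp }
    rw [← e.tsum_eq, ENNReal.tsum_prod (f := fun j c => walkWeight i (e (j, c)).toList)]
    have : ∀ j (c : List.Vector (ℤ × ℤ) n),
        walkWeight i (e (j, c)).toList = stepWeight i j * walkWeight j c.toList := fun j c => rfl
    simp_rw [this, ENNReal.tsum_mul_left, ih, ENNReal.tsum_mul_right, tsum_stepWeight, pow_succ']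

lemma abs_floor_sub_floor_le (x y : ℝ) : (|⌊y⌋ - ⌊x⌋| : ℤ) ≤ |y - x| + 1 := by
  rw [Int.cast_abs, Int.cast_sub, abs_le]
  have h1 := Int.floor_le x
  have h2 := Int.lt_floor_add_one x
  have h3 := Int.floor_le y
  have h4 := Int.lt_floor_add_one y
  constructor
  · linarith [neg_abs_le (y - x)]
  · linarith [le_abs_self (y - x)]

/-- The walk that a chain induces on the grid is not much longer than the chain. -/
lemma le_walkWeight {h : ℝ} (hh : 0 < h) (a : ℂ) (l : List ℂ) :
    ENNReal.ofReal (Real.exp (-(2 * chainLength univ a l / h + 2 * l.length))) ≤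
      walkWeight (cellIndex h a) (l.map (cellIndex h)) := by
  induction l generalizing a with
  | nil => simp [walkWeight, chainLength, Metric.infDist_zero_of_mem]
  | cons p l ih =>
    simp only [List.map_cons, walkWeight, chainLength, List.length_cons]
    refine le_trans ?_ (mul_le_mul_right (ih p) _)
    rw [stepWeight, ← ENNReal.ofReal_mul (Real.exp_pos _).le, ← Real.exp_add]
    refine ENNReal.ofReal_le_ofReal (Real.exp_le_exp.2 ?_)
    have h1 := abs_floor_sub_floor_le (a.re / h) (p.re / h)
    have h2 := abs_floor_sub_floor_le (a.im / h) (p.im / h)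
    have hre : |p.re / h - a.re / h| ≤ dist a p / h := by
      rw [← sub_div, abs_div, abs_of_pos hh, dist_comm, dist_eq_norm]
      gcongr
      exact Complex.abs_re_le_norm (p - a)
    have him : |p.im / h - a.im / h| ≤ dist a p / h := by
      rw [← sub_div, abs_div, abs_of_pos hh, dist_comm, dist_eq_norm]
      gcongr
      exact Complex.abs_im_le_norm (p - a)
    simp only [cellIndex, mul_add, add_div]
    push_cast at h1 h2 ⊢
    have e1 : 2 * dist a p / h = 2 * (dist a p / h) := by ring
    rw [e1]
    linarith

/-! ### Occupied walks of a Poisson process -/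

/-- The configuration has enough points in the cells of the walk `c` to let each visit of `c` to a
cell collect a new point. -/
def IsOccupied (h : ℝ) (ω : Set ℂ) (c : List (ℤ × ℤ)) : Prop :=
  ∀ i ∈ c, c.count i ≤ count ω (cell h i)

lemma IsChainOf.isOccupied {h : ℝ} (hh : 0 < h) {ω : Set ℂ}
    (hω : ∀ B, Bornology.IsBounded B → (ω ∩ B).Finite) {l : List ℂ} (hl : IsChainOf ω l) :
    IsOccupied h ω (l.map (cellIndex h)) := by
  classical
  intro i _
  have : (l.map (cellIndex h)).count i = (l.filter (fun z => cellIndex h z = i)).length := by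
    rw [List.count, List.countP_map, List.countP_eq_length_filter]
    congr 1
    refine List.filter_congr fun z _ => ?_
    rw [Bool.eq_iff_iff]
    simp
  rw [this, ← List.toFinset_card_of_nodup (hl.1.filter _), ← ncard_coe_finset]
  refine ncard_le_ncard (fun p hp => ?_) (hω _ (isBounded_cell hh i))
  have hp : p ∈ l ∧ cellIndex h p = i := by simpa using hp
  exact ⟨hl.2 p hp.1, hp.2⟩

/-- The tail of a Poisson law: `(n + k)! ≥ n!` suffices. -/
lemma poissonMeasure_Ici_le (r : ℝ≥0) (k : ℕ) : poissonMeasure r (Ici k) ≤ (r : ℝ≥0∞) ^ k := by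
  have h1 : poissonMeasure r (Ici k) = ∑' n : ℕ, poissonMeasure r {n + k} := by
    rw [← measure_iUnion]
    · congr 1
      ext m
      simp only [mem_Ici, mem_iUnion, mem_singleton_iff]
      exact ⟨fun h => ⟨m - k, by omega⟩, fun ⟨n, h⟩ => by omega⟩
    · intro m n hmn
      simpa using hmn
    · exact fun n => measurableSet_singleton _
  have h2 : ∀ n : ℕ, poissonMeasure r {n + k} ≤ (r : ℝ≥0∞) ^ k * poissonMeasure r {n} := by
    intro n
    rw [poissonMeasure_singleton, poissonMeasure_singleton, ← ENNReal.ofReal_coe_nnreal,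
      ← ENNReal.ofReal_pow r.coe_nonneg, ← ENNReal.ofReal_mul (by positivity)]
    refine ENNReal.ofReal_le_ofReal ?_
    calc Real.exp (-r) * r ^ (n + k) / ((n + k).factorial : ℝ)
        ≤ Real.exp (-r) * r ^ (n + k) / (n.factorial : ℝ) := by
          gcongr
          omega
      _ = _ := by rw [pow_add]; ring
  rw [h1]
  refine (ENNReal.tsum_le_tsum h2).trans ?_
  rw [ENNReal.tsum_mul_left, ← measure_iUnion (fun m n hmn => by simpa using hmn)
    fun n => measurableSet_singleton _]
  calc _ ≤ (r : ℝ≥0∞) ^ k * 1 := by gcongr; exact prob_le_one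
    _ = _ := mul_one _

variable {Ω : Type*} [MeasurableSpace Ω] {μ : Measure Ω} {ω : Ω → Set ℂ}

lemma IsUnitPoissonProcess.measurableSet_le_count (hω : IsUnitPoissonProcess μ ω) {B : Set ℂ}
    (hB : MeasurableSet B) (hb : Bornology.IsBounded B) (k : ℕ) :
    MeasurableSet {w | k ≤ count (ω w) B} :=
  hω.measurable_count B hB hb measurableSet_Ici

lemma IsUnitPoissonProcess.measurableSet_isOccupied (hω : IsUnitPoissonProcess μ ω) {h : ℝ}
    (hh : 0 < h) (c : List (ℤ × ℤ)) : MeasurableSet {w | IsOccupied h (ω w) c} := by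
  have : {w | IsOccupied h (ω w) c} = ⋂ i ∈ c.toFinset, {w | c.count i ≤ count (ω w) (cell h i)} := by
    ext w; simp [IsOccupied]
  rw [this]
  exact Finset.measurableSet_biInter _ fun i _ =>
    hω.measurableSet_le_count (measurableSet_cell h i) (isBounded_cell hh i) _

/-- By independence of the cells, each step of a walk costs a factor of at most the area of a
cell. -/
lemma IsUnitPoissonProcess.measure_isOccupied_le (hω : IsUnitPoissonProcess μ ω) {h : ℝ}
    (hh : 0 < h) (c : List (ℤ × ℤ)) :
    μ {w | IsOccupied h (ω w) c} ≤ ENNReal.ofReal (h ^ 2) ^ c.length := by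
  set m := c.toFinset.card
  let e : Fin m ≃ c.toFinset := c.toFinset.equivFin.symm
  have hind := hω.indep_count m (fun j => cell h (e j)) (fun j => measurableSet_cell h _)
    (fun j => isBounded_cell hh _)
    (fun j k hjk => disjoint_cell h fun hc => hjk (e.injective (Subtype.ext hc)))
  have hset : {w | IsOccupied h (ω w) c} =
      ⋂ j ∈ (Finset.univ : Finset (Fin m)), (fun w => count (ω w) (cell h (e j))) ⁻¹'
        Ici (c.count (e j : ℤ × ℤ)) := by
    ext w
    simp only [IsOccupied, mem_ofPred_eq, Finset.mem_univ, iInter_true, mem_iInter, mem_preimage,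
      mem_Ici]
    refine ⟨fun H j => H _ (List.mem_toFinset.1 (e j).2), fun H i hi => ?_⟩
    simpa using H (e.symm ⟨i, List.mem_toFinset.2 hi⟩)
  rw [hset, hind.measure_inter_preimage_eq_mul Finset.univ fun _ _ => measurableSet_Ici]
  calc ∏ j, μ ((fun w => count (ω w) (cell h (e j))) ⁻¹' Ici (c.count (e j : ℤ × ℤ)))
      ≤ ∏ j, ENNReal.ofReal (h ^ 2) ^ c.count (e j : ℤ × ℤ) := by
        refine Finset.prod_le_prod' fun j _ => ?_
        rw [← Measure.map_apply (hω.measurable_count _ (measurableSet_cell h _)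
          (isBounded_cell hh _)) measurableSet_Ici, hω.law_count _ (measurableSet_cell h _)
          (isBounded_cell hh _), volume_cell hh]
        exact poissonMeasure_Ici_le _ _
    _ = ENNReal.ofReal (h ^ 2) ^ c.length := by
        rw [Finset.prod_pow_eq_pow_sum, e.sum_comp (fun i => c.count (i : ℤ × ℤ)),
          Finset.sum_coe_sort c.toFinset (fun i => c.count i)]
        congr 1
        convert List.sum_toFinset_count_eq_length c

/-! ### Chains collect points at a bounded rate -/

/-- The sum, over all occupied walks `c` from the origin, of `|c|² e^{4 |c|}` times the weight
of `c`. -/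
def occupation (h : ℝ) (ω : Set ℂ) : ℝ≥0∞ :=
  ∑' n : ℕ, ∑' c : List.Vector (ℤ × ℤ) n,
    ((n : ℝ≥0∞) ^ 2 * ENNReal.ofReal (Real.exp 4) ^ n * walkWeight 0 c.toList) *
      {ω' | IsOccupied h ω' c.toList}.indicator 1 ω

/-- A chain with many points in comparison to its length forces `occupation` to be large. -/
lemma IsChainOf.sq_length_le_occupation {h : ℝ} (hh : 0 < h) {ω : Set ℂ}
    (hω : ∀ B, Bornology.IsBounded B → (ω ∩ B).Finite) {l : List ℂ} (hl : IsChainOf ω l)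
    (hlen : chainLength univ 0 l ≤ h * l.length) :
    (l.length : ℝ≥0∞) ^ 2 ≤ occupation h ω := by
  refine le_trans ?_ (ENNReal.le_tsum l.length)
  obtain ⟨c, hc⟩ : ∃ c : List.Vector (ℤ × ℤ) l.length, c.toList = l.map (cellIndex h) :=
    ⟨⟨l.map (cellIndex h), by simp⟩, rfl⟩
  refine le_trans ?_ (ENNReal.le_tsum c)
  rw [hc]
  have hocc : ω ∈ {ω' | IsOccupied h ω' (l.map (cellIndex h))} := hl.isOccupied hh hω
  rw [indicator_of_mem hocc, Pi.one_apply, mul_one, mul_assoc]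
  refine le_mul_of_one_le_right (zero_le) ?_
  have h0 : cellIndex h 0 = 0 := by simp [cellIndex]
  have hw := le_walkWeight hh 0 l
  rw [h0] at hw
  refine le_trans ?_ (mul_le_mul_right hw _)
  rw [← ENNReal.ofReal_pow (Real.exp_pos _).le, ← ENNReal.ofReal_mul (by positivity),
    ← Real.exp_nat_mul, ← Real.exp_add, ENNReal.one_le_ofReal, Real.one_le_exp_iff]
  have : 2 * chainLength univ 0 l / h ≤ 2 * l.length := by
    rw [div_le_iff₀ hh]; linarith
  linarith

lemma IsUnitPoissonProcess.measurable_occupation (hω : IsUnitPoissonProcess μ ω) {h : ℝ}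
    (hh : 0 < h) : Measurable fun w => occupation h (ω w) := by
  refine Measurable.tsum fun n => Measurable.tsum fun c => ?_
  exact (Measurable.indicator (f := fun _ => 1) measurable_const
    (hω.measurableSet_isOccupied hh c.toList)).const_mul _

/-- On a fine grid the occupied walks are subcritical. -/
lemma IsUnitPoissonProcess.exists_lintegral_occupation_ne_top (hω : IsUnitPoissonProcess μ ω) :
    ∃ h : ℝ, 0 < h ∧ ∫⁻ w, occupation h (ω w) ∂μ ≠ ⊤ := by
  -- `e⁴` is the factor per step in `occupation`, `h²` the area of a cell
  obtain ⟨h, hh, hsmall⟩ : ∃ h : ℝ, 0 < h ∧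
      ENNReal.ofReal (Real.exp 4) * totalWeight * ENNReal.ofReal (h ^ 2) ≤ ENNReal.ofReal (1 / 2) := by
    set b := totalWeight.toReal
    have hb : 0 ≤ b := ENNReal.toReal_nonneg
    have hpos : 0 < 2 * Real.exp 4 * (b + 1) := by positivity
    refine ⟨Real.sqrt (1 / (2 * Real.exp 4 * (b + 1))), by positivity, ?_⟩
    rw [Real.sq_sqrt (by positivity), ← ENNReal.ofReal_toReal totalWeight_ne_top,
      ← ENNReal.ofReal_mul (by positivity), ← ENNReal.ofReal_mul (by positivity)]
    refine ENNReal.ofReal_le_ofReal ?_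
    rw [mul_one_div, div_le_iff₀ hpos]
    nlinarith [Real.exp_pos 4]
  have hgeom : ∑' n : ℕ, ENNReal.ofReal ((n : ℝ) ^ 2 * (1 / 2) ^ n) ≠ ⊤ :=
    (summable_pow_mul_geometric_of_norm_lt_one 2
      (by norm_num : ‖(1 / 2 : ℝ)‖ < 1)).tsum_ofReal_ne_top
  have heq : ∫⁻ w, occupation h (ω w) ∂μ = ∑' n : ℕ, ∑' c : List.Vector (ℤ × ℤ) n,
      ((n : ℝ≥0∞) ^ 2 * ENNReal.ofReal (Real.exp 4) ^ n * walkWeight 0 c.toList) *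
        μ {w | IsOccupied h (ω w) c.toList} := by
    have hm : ∀ (n : ℕ) (c : List.Vector (ℤ × ℤ) n), Measurable fun w =>
        ((n : ℝ≥0∞) ^ 2 * ENNReal.ofReal (Real.exp 4) ^ n * walkWeight 0 c.toList) *
          {ω' | IsOccupied h ω' c.toList}.indicator (1 : Set ℂ → ℝ≥0∞) (ω w) := fun n c =>
      (Measurable.indicator (f := fun _ => 1) measurable_const
        (hω.measurableSet_isOccupied hh c.toList)).const_mul _
    simp only [occupation]
    rw [lintegral_tsum fun n => (Measurable.tsum (hm n)).aemeasurable]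
    congr 1; funext n
    rw [lintegral_tsum fun c => (hm n c).aemeasurable]
    congr 1; funext c
    have hi : Measurable fun w => {ω' | IsOccupied h ω' c.toList}.indicator (1 : Set ℂ → ℝ≥0∞) (ω w) :=
      Measurable.indicator (f := fun _ => 1) measurable_const (hω.measurableSet_isOccupied hh c.toList)
    rw [lintegral_const_mul _ hi]
    congr 1
    exact lintegral_indicator_one (hω.measurableSet_isOccupied hh c.toList)
  refine ⟨h, hh, ne_top_of_le_ne_top hgeom (heq.trans_le (ENNReal.tsum_le_tsum fun n => ?_))⟩
  · calc ∑' c : List.Vector (ℤ × ℤ) n,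
        ((n : ℝ≥0∞) ^ 2 * ENNReal.ofReal (Real.exp 4) ^ n * walkWeight 0 c.toList) *
          μ {w | IsOccupied h (ω w) c.toList}
        ≤ ∑' c : List.Vector (ℤ × ℤ) n,
        ((n : ℝ≥0∞) ^ 2 * ENNReal.ofReal (Real.exp 4) ^ n * walkWeight 0 c.toList) *
          ENNReal.ofReal (h ^ 2) ^ n := by
          refine ENNReal.tsum_le_tsum fun c => mul_le_mul_right ?_ _
          simpa using hω.measure_isOccupied_le hh c.toList
      _ = (n : ℝ≥0∞) ^ 2 *
          (ENNReal.ofReal (Real.exp 4) * totalWeight * ENNReal.ofReal (h ^ 2)) ^ n := by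
          rw [ENNReal.tsum_mul_right, ENNReal.tsum_mul_left, tsum_walkWeight]
          ring
      _ ≤ (n : ℝ≥0∞) ^ 2 * ENNReal.ofReal (1 / 2) ^ n := by gcongr
      _ = ENNReal.ofReal ((n : ℝ) ^ 2 * (1 / 2) ^ n) := by
          rw [ENNReal.ofReal_mul (by positivity), ENNReal.ofReal_pow (by positivity),
            ENNReal.ofReal_pow (by positivity), ENNReal.ofReal_natCast]

lemma chainLength_univ_le (S : Set ℂ) (a : ℂ) (l : List ℂ) :
    chainLength univ a l ≤ chainLength S a l := by
  induction l generalizing a with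
  | nil => simpa [chainLength, Metric.infDist_zero_of_mem] using Metric.infDist_nonneg
  | cons p l ih => exact add_le_add le_rfl (ih p)

/-- The number of points of a chain is at most a constant times its length, up to a
square-integrable random term that does not depend on the chain. -/
theorem IsUnitPoissonProcess.exists_length_le (hω : IsUnitPoissonProcess μ ω) :
    ∃ h : ℝ, 0 < h ∧ ∃ T : Ω → ℝ, Measurable T ∧ (∀ w, 0 ≤ T w) ∧ MemLp T 2 μ ∧
      ∀ᵐ w ∂μ, ∀ l, IsChainOf (ω w) l → ∀ S, (l.length : ℝ) ≤ chainLength S 0 l / h + T w := by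
  obtain ⟨h, hh, hfin⟩ := hω.exists_lintegral_occupation_ne_top
  have hm := hω.measurable_occupation hh
  refine ⟨h, hh, fun w => Real.sqrt (occupation h (ω w)).toReal, hm.ennreal_toReal.sqrt,
    fun w => Real.sqrt_nonneg _, ?_, ?_⟩
  · rw [memLp_two_iff_integrable_sq hm.ennreal_toReal.sqrt.aestronglyMeasurable]
    simp_rw [Real.sq_sqrt ENNReal.toReal_nonneg]
    exact integrable_toReal_of_lintegral_ne_top hm.aemeasurable hfin
  · filter_upwards [ae_lt_top hm hfin] with w hw l hl S
    have hS := chainLength_univ_le S 0 l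
    rcases le_total (chainLength univ 0 l) (h * l.length) with hle | hle
    · have := ENNReal.toReal_mono hw.ne (hl.sq_length_le_occupation hh (hω.locallyFinite w) hle)
      have h1 : (l.length : ℝ) ≤ Real.sqrt (occupation h (ω w)).toReal :=
        Real.le_sqrt_of_sq_le (by simpa using this)
      have h2 : 0 ≤ chainLength S 0 l / h := div_nonneg (chainLength_nonneg _ _ _) hh.le
      linarith
    · have h1 : (l.length : ℝ) ≤ chainLength S 0 l / h := by
        rw [le_div_iff₀ hh]; linarith
      linarith [Real.sqrt_nonneg (occupation h (ω w)).toReal]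

/-! ### Measurability of the action -/

lemma chainLength_map_le {α : Type*} (S : Set ℂ) (f g : α → ℂ) {ρ : ℝ} (d : List α)
    (h : ∀ i ∈ d, dist (f i) (g i) ≤ ρ) (a b : ℂ) :
    chainLength S a (d.map f) ≤ chainLength S b (d.map g) + dist a b + 2 * ρ * d.length := by
  induction d generalizing a b with
  | nil => simpa [chainLength] using Metric.infDist_le_infDist_add_dist
  | cons i d ih =>
    have h1 := ih (fun j hj => h j (by simp [hj])) (f i) (g i)
    have h2 := h i (by simp)
    have h3 := dist_triangle4 a b (g i) (f i)
    rw [dist_comm (g i)] at h3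
    simp only [List.map_cons, chainLength, List.length_cons]
    push_cast
    linarith

/-- That some chain costs less than `r` can be read off from the numbers of points in countably
many balls, since the cost depends continuously on the chain. -/
lemma IsUnitPoissonProcess.measurableSet_exists_chainCost_lt (hω : IsUnitPoissonProcess μ ω)
    (S : Set ℂ) {s : ℝ} (hs : 0 < s) (r : ℝ) :
    MeasurableSet {w | ∃ l, IsChainOf (ω w) l ∧ chainCost S s l < r} := by
  let x : ℕ → ℂ := TopologicalSpace.denseSeq ℂ
  let ρ : ℕ → ℝ := fun k => 1 / ((k : ℝ) + 1)
  have hρ : ∀ k, 0 < ρ k := fun k => Nat.one_div_pos_of_nat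
  have hρlim : Filter.Tendsto ρ Filter.atTop (nhds 0) := tendsto_one_div_add_atTop_nhds_zero_nat
  let P : List ℕ → ℕ → Prop := fun d k =>
    d.Pairwise (fun i j => 2 * ρ k ≤ dist (x i) (x j)) ∧
      (chainLength S 0 (d.map x) + 2 * ρ k * d.length) ^ 2 / (2 * s) - d.length < r
  have hset : {w | ∃ l, IsChainOf (ω w) l ∧ chainCost S s l < r} =
      ⋃ (d : List ℕ) (k : ℕ) (_ : P d k), ⋂ i ∈ d.toFinset,
        {w | 1 ≤ count (ω w) (Metric.ball (x i) (ρ k))} := by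
    ext w
    simp only [mem_ofPred_eq, mem_iUnion, mem_iInter, List.mem_toFinset, exists_prop]
    constructor
    · rintro ⟨l, hl, hcost⟩
      have h1 : ∀ᶠ k in Filter.atTop, ∀ p ∈ (l.toFinset : Set ℂ), ∀ q ∈ (l.toFinset : Set ℂ),
          p ≠ q → 4 * ρ k ≤ dist p q := by
        rw [Filter.eventually_all_finite (Finset.finite_toSet _)]
        intro p _
        rw [Filter.eventually_all_finite (Finset.finite_toSet _)]
        intro q _
        by_cases hpq : p = q
        · simp [hpq]
        · have : Filter.Tendsto (fun k => 4 * ρ k) Filter.atTop (nhds (4 * 0)) :=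
            hρlim.const_mul 4
          rw [mul_zero] at this
          filter_upwards [this.eventually_le_const (dist_pos.2 hpq)] with k hk _ using hk
      have h2 : ∀ᶠ k in Filter.atTop,
          (chainLength S 0 l + 4 * ρ k * l.length) ^ 2 / (2 * s) - l.length < r := by
        have : Filter.Tendsto
            (fun k => (chainLength S 0 l + 4 * ρ k * l.length) ^ 2 / (2 * s) - l.length)
            Filter.atTop
            (nhds ((chainLength S 0 l + 4 * 0 * l.length) ^ 2 / (2 * s) - l.length)) :=
          ((((hρlim.const_mul 4).mul_const _).const_add _ |>.pow 2).div_const _).sub_const _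
        refine this.eventually_lt_const ?_
        simpa [chainCost] using hcost
      -- for a fine resolution, move each point to a nearby point of the dense sequence
      obtain ⟨k, hk1, hk2⟩ := (h1.and h2).exists
      have hex : ∀ p : ℂ, ∃ i, dist p (x i) < ρ k := fun p =>
        (TopologicalSpace.denseRange_denseSeq ℂ).exists_dist_lt p (hρ k)
      choose i hi using hex
      refine ⟨l.map i, k, ⟨?_, ?_⟩, ?_⟩
      · rw [List.pairwise_map]
        refine hl.1.imp_of_mem fun {p q} hp hq hpq => ?_
        have h3 := hk1 p (by simpa using hp) q (by simpa using hq) hpq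
        have h4 := dist_triangle4 p (x (i p)) (x (i q)) q
        have h5 := hi q
        rw [dist_comm] at h5
        linarith [hi p]
      · have h3 := chainLength_map_le S (fun p => x (i p)) id l
          (fun p _ => by rw [dist_comm]; exact (hi p).le) 0 0
        rw [List.map_id, dist_self, add_zero] at h3
        rw [List.length_map, List.map_map]
        refine lt_of_le_of_lt ?_ hk2
        have h4 : 0 ≤ 2 * ρ k * l.length := by have := hρ k; positivity
        have h5 := chainLength_nonneg S 0 (l.map (x ∘ i))
        have h6 : chainLength S 0 (l.map (x ∘ i)) ≤ _ := h3
        have h7 : chainLength S 0 (l.map (x ∘ i)) + 2 * ρ k * l.length ≤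
            chainLength S 0 l + 4 * ρ k * l.length := by linarith
        gcongr ?_ ^ 2 / (2 * s) - _
      · intro j hj
        obtain ⟨p, hp, rfl⟩ := List.mem_map.1 hj
        rw [count, Nat.one_le_iff_ne_zero, ← pos_iff_ne_zero,
          ncard_pos (hω.locallyFinite w _ Metric.isBounded_ball)]
        exact ⟨p, hl.2 p hp, hi p⟩
    · rintro ⟨d, k, ⟨hd, hcost⟩, hmem⟩
      have hex : ∀ i, ∃ p, i ∈ d → p ∈ ω w ∧ dist p (x i) < ρ k := by
        intro i
        by_cases hi : i ∈ d
        · have := hmem i hi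
          rw [count, Nat.one_le_iff_ne_zero, ← pos_iff_ne_zero,
            ncard_pos (hω.locallyFinite w _ Metric.isBounded_ball)] at this
          obtain ⟨p, hp, hp'⟩ := this
          exact ⟨p, fun _ => ⟨hp, hp'⟩⟩
        · exact ⟨0, fun h => absurd h hi⟩
      choose p hp using hex
      refine ⟨d.map p, ⟨?_, ?_⟩, ?_⟩
      · rw [List.Nodup, List.pairwise_map]
        refine hd.imp_of_mem fun {i j} hi hj hij he => ?_
        have h1 := (hp i hi).2
        have h2 := (hp j hj).2
        rw [he, dist_comm] at h1
        linarith [dist_triangle (x i) (p j) (x j)]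
      · intro q hq
        obtain ⟨i, hi, rfl⟩ := List.mem_map.1 hq
        exact (hp i hi).1
      · have h3 := chainLength_map_le S p x d (fun i hi => (hp i hi).2.le) 0 0
        rw [dist_self, add_zero] at h3
        refine lt_of_le_of_lt ?_ hcost
        rw [chainCost, List.length_map]
        have h5 := chainLength_nonneg S 0 (d.map p)
        gcongr
  rw [hset]
  exact .iUnion fun d => .iUnion fun k => .iUnion fun _ => Finset.measurableSet_biInter _
    fun i _ => hω.measurableSet_le_count measurableSet_ball Metric.isBounded_ball 1

/-- Boundedness below is needed: `sInf` takes a junk value on unbounded sets, so the sublevel sets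
are described by single chains only where the costs are bounded. -/
lemma IsUnitPoissonProcess.aemeasurable_sInf_chainCost (hω : IsUnitPoissonProcess μ ω)
    (S : Set ℂ) {s : ℝ} (hs : 0 < s)
    (hbdd : ∀ᵐ w ∂μ, BddBelow (chainCost S s '' {l | IsChainOf (ω w) l})) :
    AEMeasurable (fun w => sInf (chainCost S s '' {l | IsChainOf (ω w) l})) μ := by
  obtain ⟨G, hG, hGm, hGμ⟩ : ∃ G ⊆ {w | BddBelow (chainCost S s '' {l | IsChainOf (ω w) l})},
      MeasurableSet G ∧ μ Gᶜ = 0 := by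
    obtain ⟨N, hN, hNm, hN0⟩ := exists_measurable_superset_of_null hbdd
    exact ⟨Nᶜ, compl_subset_comm.1 hN, hNm.compl, by rwa [compl_compl]⟩
  refine ⟨G.indicator fun w => sInf (chainCost S s '' {l | IsChainOf (ω w) l}), ?_, ?_⟩
  · refine measurable_of_Iio fun r => ?_
    have : (G.indicator fun w => sInf (chainCost S s '' {l | IsChainOf (ω w) l})) ⁻¹' Iio r =
        (G ∩ {w | ∃ l, IsChainOf (ω w) l ∧ chainCost S s l < r}) ∪ (Gᶜ ∩ {_w | 0 < r}) := by
      ext w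
      by_cases hw : w ∈ G
      · have hne : (chainCost S s '' {l | IsChainOf (ω w) l}).Nonempty :=
          ⟨_, [], ⟨List.nodup_nil, by simp⟩, rfl⟩
        simp [hw, csInf_lt_iff (hG hw) hne]
      · simp [hw]
    rw [this]
    exact (hGm.inter (hω.measurableSet_exists_chainCost_lt S hs r)).union
      (hGm.compl.inter (.const _))
  · have : ∀ᵐ w ∂μ, w ∈ G := hGμ
    filter_upwards [this] with w hw
    rw [indicator_of_mem hw]

/-! ### Null sets contain no points -/

lemma IsUnitPoissonProcess.ae_disjoint (hω : IsUnitPoissonProcess μ ω) {B : Set ℂ}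
    (hB : MeasurableSet B) (hb : Bornology.IsBounded B) (h0 : volume B = 0) :
    ∀ᵐ w ∂μ, Disjoint B (ω w) := by
  have h1 : μ {w | 1 ≤ count (ω w) B} = 0 := by
    have := poissonMeasure_Ici_le 0 1
    rw [← ENNReal.toNNReal_zero, ← h0, ← hω.law_count B hB hb,
      Measure.map_apply (hω.measurable_count B hB hb) measurableSet_Ici] at this
    refine le_antisymm (this.trans ?_) zero_le
    simp [h0]
  have h2 : ∀ᵐ w ∂μ, ¬ 1 ≤ count (ω w) B := by
    rw [ae_iff]; simpa only [not_not] using h1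
  filter_upwards [h2] with w hw
  rw [not_le, Nat.lt_one_iff, count, ncard_eq_zero (hω.locallyFinite w B hb)] at hw
  exact (disjoint_iff_inter_eq_empty.2 hw).symm

lemma volume_image_line (p v : ℂ) (A : Set ℝ) :
    volume ((fun a : ℝ => p + (a : ℂ) * v) '' A) = 0 := by
  refine measure_mono_null (t := (AffineSubspace.mk' p (Submodule.span ℝ {v}) : Set ℂ)) ?_
    (Measure.addHaar_affineSubspace _ _ fun h => ?_)
  · rintro _ ⟨a, -, rfl⟩
    rw [SetLike.mem_coe, AffineSubspace.mem_mk']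
    simpa using Submodule.smul_mem _ a (Submodule.mem_span_singleton_self v)
  · have h1 := congrArg AffineSubspace.direction h
    rw [AffineSubspace.direction_mk', AffineSubspace.direction_top] at h1
    have h2 := finrank_span_le_card (R := ℝ) ({v} : Set ℂ)
    rw [h1, finrank_top, Complex.finrank_real_complex] at h2
    simp at h2

/-! ### Comparison of two targets -/

lemma chainLength_le_add {S S' : Set ℂ} (hS : S.Nonempty) {d : ℝ}
    (h : ∀ x ∈ S, ∃ y ∈ S', dist x y ≤ d) (a : ℂ) (l : List ℂ) :
    chainLength S' a l ≤ chainLength S a l + d := by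
  induction l generalizing a with
  | nil =>
    refine le_of_forall_gt fun r hr => ?_
    obtain ⟨x, hx, hxr⟩ := (Metric.infDist_lt_iff (x := a) (r := r - d) hS).1
      (by simp only [chainLength] at hr; linarith)
    obtain ⟨y, hy, hxy⟩ := h x hx
    have := Metric.infDist_le_dist_of_mem (x := a) hy
    simp only [chainLength]
    linarith [dist_triangle a x y]
  | cons p l ih => simp only [chainLength]; linarith [ih p]

section Deterministic

variable {𝒞 : Set (List ℂ)} {h T c t : ℝ}

/-- If chains collect points at a bounded rate, then the kinetic term dominates the number of
points. -/
lemma sq_div_le_chainCost (hh : 0 < h) {s : ℝ} (hs : 0 < s) {S : Set ℂ} {l : List ℂ}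
    (hl : (l.length : ℝ) ≤ chainLength S 0 l / h + T) :
    chainLength S 0 l ^ 2 / (4 * s) - s / h ^ 2 - T ≤ chainCost S s l := by
  rw [chainCost]
  set L := chainLength S 0 l
  have h1 : 0 ≤ (L / 2 - s / h) ^ 2 / s := by positivity
  have h2 : (L / 2 - s / h) ^ 2 / s = L ^ 2 / (4 * s) - L / h + s / h ^ 2 := by
    field_simp; ring
  have h3 : L ^ 2 / (2 * s) = L ^ 2 / (4 * s) + L ^ 2 / (4 * s) := by field_simp; ring
  linarith

lemma bddBelow_chainCost (hh : 0 < h) {s : ℝ} (hs : 0 < s) {S : Set ℂ}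
    (hl : ∀ l ∈ 𝒞, (l.length : ℝ) ≤ chainLength S 0 l / h + T) :
    BddBelow (chainCost S s '' 𝒞) := by
  refine ⟨-(s / h ^ 2) - T, ?_⟩
  rintro _ ⟨l, hl', rfl⟩
  have := sq_div_le_chainCost hh hs (hl l hl')
  have h0 : 0 ≤ chainLength S 0 l ^ 2 / (4 * s) := by positivity
  linarith

lemma sInf_chainCost_le (h𝒞 : [] ∈ 𝒞) (hc : 0 < c) (ht : 0 < t) {S : Set ℂ}
    (hb : BddBelow (chainCost S (c * t) '' 𝒞)) (hSt : Metric.infDist 0 S ≤ t) :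
    sInf (chainCost S (c * t) '' 𝒞) ≤ t / (2 * c) := by
  refine (csInf_le hb ⟨[], h𝒞, rfl⟩).trans ?_
  have h1 : Metric.infDist 0 S ^ 2 ≤ t ^ 2 := by
    gcongr
    exact Metric.infDist_nonneg
  simp only [chainCost, chainLength, List.length_nil, Nat.cast_zero, sub_zero]
  rw [div_le_div_iff₀ (by positivity) (by positivity)]
  nlinarith [mul_le_mul_of_nonneg_right h1 hc.le]

/-- A constant for the comparison of two targets: the terms before `4 * …` come from the crude bound
on each infimum, the last one from moving the end of a nearly optimal chain. -/
def comparisonConst (c h : ℝ) : ℝ := 1 / (2 * c) + c / h ^ 2 + 1 +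
  4 * ((4 * c * (1 / (2 * c) + 2 + c / h ^ 2) + 1) + 2) / c

/-- One target is reached at almost the cost of the other: at distance at most `4 t ϑ²`, a nearly
optimal chain of length `O(t + T)` serves both; for `ϑ > 1` the crude bounds on each of the
infima suffice. -/
lemma sInf_chainCost_le_add (h𝒞 : [] ∈ 𝒞) (hh : 0 < h) (hT : 0 ≤ T) (hc : 0 < c) (ht : 0 < t)
    (hlen : ∀ l ∈ 𝒞, ∀ S, (l.length : ℝ) ≤ chainLength S 0 l / h + T) {S S' : Set ℂ}
    (hS : S.Nonempty) (hSt : Metric.infDist 0 S ≤ t) (hSt' : Metric.infDist 0 S' ≤ t) {θ : ℝ}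
    (hθ : 0 ≤ θ) (hd : θ ≤ 1 → ∀ x ∈ S, ∃ y ∈ S', dist x y ≤ 4 * (t * θ ^ 2)) :
    sInf (chainCost S' (c * t) '' 𝒞) ≤
      sInf (chainCost S (c * t) '' 𝒞) + comparisonConst c h * (θ ^ 2 * (t + T)) := by
  have hs : 0 < c * t := by positivity
  have hb := bddBelow_chainCost (𝒞 := 𝒞) hh hs fun l hl => hlen l hl S
  have hb' := bddBelow_chainCost (𝒞 := 𝒞) hh hs fun l hl => hlen l hl S'
  have hup := sInf_chainCost_le h𝒞 hc ht hb hSt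
  have hup' := sInf_chainCost_le h𝒞 hc ht hb' hSt'
  have hne : (chainCost S (c * t) '' 𝒞).Nonempty := ⟨_, [], h𝒞, rfl⟩
  set K := 4 * c * (1 / (2 * c) + 2 + c / h ^ 2) + 1 with hK
  have hK0 : 0 < K := by positivity
  have hCC : comparisonConst c h = (1 / (2 * c) + c / h ^ 2 + 1) + 4 * (K + 2) / c := rfl
  have hA : 0 ≤ 1 / (2 * c) + c / h ^ 2 + 1 := by positivity
  have hB : 0 ≤ 4 * (K + 2) / c := by positivity
  have hX : 0 ≤ θ ^ 2 * (t + T) := by positivity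
  rcases le_or_gt θ 1 with hθ1 | hθ1
  · refine le_of_forall_pos_le_add fun ε hε => ?_
    -- the cap `t` on the slack keeps the length of the chain `O(t + T)`
    obtain ⟨_, ⟨l, hl, rfl⟩, hlt⟩ := exists_lt_of_csInf_lt hne
      (lt_add_of_pos_right (sInf (chainCost S (c * t) '' 𝒞)) (lt_min hε ht))
    set L := chainLength S 0 l with hL
    have hL0 : 0 ≤ L := chainLength_nonneg _ _ _
    have hLbound : L ≤ K * (t + T) := by
      have h1 := sq_div_le_chainCost hh hs (hlen l hl S)
      have h2 : L ^ 2 / (4 * (c * t)) ≤ t / (2 * c) + t + T + c * t / h ^ 2 := by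
        linarith [min_le_right ε t]
      rw [div_le_iff₀ (by positivity)] at h2
      have h3 : (t / (2 * c) + t + T + c * t / h ^ 2) ≤
          (1 / (2 * c) + 2 + c / h ^ 2) * (t + T) := by
        have e : (1 / (2 * c) + 2 + c / h ^ 2) * (t + T) =
          (t / (2 * c) + t + T + c * t / h ^ 2) + (1 / (2 * c) * T + t + T + c / h ^ 2 * T) := by
          ring
        have : 0 ≤ 1 / (2 * c) * T + t + T + c / h ^ 2 * T := by positivity
        linarith
      have h4 : L ^ 2 ≤ (K - 1) * (t + T) ^ 2 := by
        calc L ^ 2 ≤ _ := h2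
          _ ≤ (1 / (2 * c) + 2 + c / h ^ 2) * (t + T) * (4 * (c * (t + T))) := by
              gcongr
              linarith
          _ = (K - 1) * (t + T) ^ 2 := by rw [hK]; ring
      have h5 : (K - 1) * (t + T) ^ 2 ≤ (K * (t + T)) ^ 2 := by
        rw [mul_pow]
        gcongr
        nlinarith
      exact le_of_sq_le_sq (h4.trans h5) (by positivity)
    set d := 4 * (t * θ ^ 2) with hdd
    have hd0 : 0 ≤ d := by positivity
    have hdt : d ≤ 4 * t := by
      have : θ ^ 2 ≤ 1 := pow_le_one₀ hθ hθ1
      nlinarith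
    have hle := chainLength_le_add hS (hd hθ1) 0 l
    have hcost : chainCost S' (c * t) l ≤ chainCost S (c * t) l +
        4 * (K + 2) / c * (θ ^ 2 * (t + T)) := by
      have h1 : chainLength S' 0 l ^ 2 ≤ L ^ 2 + 2 * (K + 2) * (t + T) * d := by
        have h2 : chainLength S' 0 l ^ 2 ≤ (L + d) ^ 2 :=
          pow_le_pow_left₀ (chainLength_nonneg _ _ _) hle 2
        have h3 : L * d ≤ K * (t + T) * d := by gcongr
        have h4 : d * d ≤ 4 * (t + T) * d := by gcongr; linarith
        nlinarith
      have h2 : 4 * (K + 2) / c * (θ ^ 2 * (t + T)) =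
          2 * (K + 2) * (t + T) * d / (2 * (c * t)) := by
        rw [hdd]; field_simp
      rw [chainCost, chainCost, h2]
      have h3 : chainLength S' 0 l ^ 2 / (2 * (c * t)) ≤
          (L ^ 2 + 2 * (K + 2) * (t + T) * d) / (2 * (c * t)) := by gcongr
      rw [add_div] at h3
      linarith
    have h1 := csInf_le hb' ⟨l, hl, rfl⟩
    have h2 := mul_nonneg hA hX
    have h3 := min_le_left ε t
    rw [hCC, add_mul]
    linarith
  · have hlow : -(c * t / h ^ 2) - T ≤ sInf (chainCost S (c * t) '' 𝒞) := by
      refine le_csInf hne ?_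
      rintro _ ⟨l, hl, rfl⟩
      have := sq_div_le_chainCost hh hs (hlen l hl S)
      have h0 : 0 ≤ chainLength S 0 l ^ 2 / (4 * (c * t)) := by positivity
      linarith
    have h1 : t / (2 * c) + c * t / h ^ 2 + T ≤ (1 / (2 * c) + c / h ^ 2 + 1) * (t + T) := by
      have e : (1 / (2 * c) + c / h ^ 2 + 1) * (t + T) =
          (t / (2 * c) + c * t / h ^ 2 + T) + (1 / (2 * c) * T + c / h ^ 2 * T + t) := by ring
      have : 0 ≤ 1 / (2 * c) * T + c / h ^ 2 * T + t := by positivity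
      linarith
    have h2 : t + T ≤ θ ^ 2 * (t + T) :=
      le_mul_of_one_le_left (by positivity) (one_le_pow₀ hθ1.le)
    have h3 := mul_le_mul_of_nonneg_left h2 hA
    have h4 := mul_nonneg hB hX
    rw [hCC, add_mul]
    linarith

end Deterministic

/-! ### The two segments -/

lemma angle_nonneg {t : ℝ} (ht : 0 < t) (γ' : ℝ) : 0 ≤ angle γ' t := Real.rpow_nonneg ht.le _

lemma rpow_eq_mul_angle {t : ℝ} (ht : 0 < t) (γ' : ℝ) : t ^ γ' = t * angle γ' t := by
  rw [angle]
  nth_rewrite 2 [← Real.rpow_one t]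
  rw [← Real.rpow_add ht]
  congr 1; ring

/-- Rotation by a small angle `ϑ` moves height `a - t ϑ` on the line `re = t` to height
about `a`, with an error of second order in `ϑ`. -/
lemma dist_rotation_le {t θ a : ℝ} (ht : 0 < t) (h0 : 0 ≤ θ) (h1 : θ ≤ 1)
    (ha : |a - t * θ| ≤ 3 / 2 * (t * θ)) :
    dist ((t : ℂ) + a * Complex.I)
      (((t : ℂ) + ((a - t * θ : ℝ) : ℂ) * Complex.I) * Complex.exp (θ * Complex.I)) ≤
      4 * (t * θ ^ 2) := by
  set b := a - t * θ with hb
  have hr := Complex.norm_exp_sub_one_sub_id_le (x := θ * Complex.I) (by simpa [abs_of_nonneg h0])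
  set r := Complex.exp (θ * Complex.I) - 1 - θ * Complex.I with hrdef
  have he : Complex.exp (θ * Complex.I) = 1 + θ * Complex.I + r := by rw [hrdef]; ring
  have hrn : ‖r‖ ≤ θ ^ 2 := by simpa [abs_of_nonneg h0] using hr
  have hab : (a : ℂ) = b + t * θ := by rw [hb]; push_cast; ring
  have hbn : ‖((b * θ : ℝ) : ℂ)‖ ≤ 3 / 2 * (t * θ) * θ := by
    rw [Complex.norm_real, Real.norm_eq_abs, abs_mul, abs_of_nonneg h0]
    gcongr
  have htn : ‖(t : ℂ) + b * Complex.I‖ ≤ t + 3 / 2 * t := by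
    refine (norm_add_le _ _).trans ?_
    rw [norm_mul, Complex.norm_I, mul_one, Complex.norm_real, Complex.norm_real, Real.norm_eq_abs,
      Real.norm_eq_abs, abs_of_pos ht]
    nlinarith
  have hdiff : (t : ℂ) + a * Complex.I - (t + b * Complex.I) * Complex.exp (θ * Complex.I) =
      ((b * θ : ℝ) : ℂ) - (t + b * Complex.I) * r := by
    rw [he, hab]
    push_cast
    linear_combination (-(b : ℂ) * θ) * Complex.I_sq
  rw [dist_eq_norm, hdiff]
  calc _ ≤ ‖((b * θ : ℝ) : ℂ)‖ + ‖((t : ℂ) + b * Complex.I) * r‖ := norm_sub_le _ _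
    _ ≤ 3 / 2 * (t * θ) * θ + (t + 3 / 2 * t) * θ ^ 2 := by
        rw [norm_mul]; gcongr
    _ = 4 * (t * θ ^ 2) := by ring

lemma segS_near_segS' {t : ℝ} (ht : 0 < t) (γ' : ℝ) (h1 : angle γ' t ≤ 1) :
    ∀ x ∈ segS γ' t, ∃ y ∈ segS' γ' t, dist x y ≤ 4 * (t * angle γ' t ^ 2) := by
  rintro _ ⟨a, ha, rfl⟩
  rw [rpow_eq_mul_angle ht] at ha
  refine ⟨_, ⟨a - t * angle γ' t, ?_, rfl⟩, dist_rotation_le ht (angle_nonneg ht γ') h1 ?_⟩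
  · rw [rpow_eq_mul_angle ht]
    constructor <;> linarith [ha.1, ha.2]
  · have := mul_nonneg ht.le (angle_nonneg ht γ')
    rw [abs_le]
    constructor <;> linarith [ha.1, ha.2]

lemma segS'_near_segS {t : ℝ} (ht : 0 < t) (γ' : ℝ) (h1 : angle γ' t ≤ 1) :
    ∀ x ∈ segS' γ' t, ∃ y ∈ segS γ' t, dist x y ≤ 4 * (t * angle γ' t ^ 2) := by
  rintro _ ⟨b, hb, rfl⟩
  rw [rpow_eq_mul_angle ht] at hb
  refine ⟨_, ⟨b + t * angle γ' t, ?_, rfl⟩, ?_⟩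
  · rw [rpow_eq_mul_angle ht]
    constructor <;> linarith [hb.1, hb.2]
  · have := mul_nonneg ht.le (angle_nonneg ht γ')
    have h2 := dist_rotation_le (a := b + t * angle γ' t) ht (angle_nonneg ht γ') h1
      (by rw [add_sub_cancel_right, abs_le]; constructor <;> linarith [hb.1, hb.2])
    rw [add_sub_cancel_right] at h2
    rwa [dist_comm]

/-- A null compact set that avoids the origin but comes within distance `t` of it. -/
structure IsTarget (S : Set ℂ) (t : ℝ) : Prop where
  nonempty : S.Nonempty
  isCompact : IsCompact S
  volume_eq_zero : volume S = 0
  zero_notMem : (0 : ℂ) ∉ S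
  infDist_le : Metric.infDist 0 S ≤ t

lemma isTarget_image {t : ℝ} (ht : 0 < t) {u : ℂ} (hu : ‖u‖ = 1) {x y : ℝ} (hx : x ≤ 0)
    (hy : 0 ≤ y) :
    IsTarget ((fun a : ℝ => ((t : ℂ) + (a : ℂ) * Complex.I) * u) '' Icc x y) t where
  nonempty := ⟨_, 0, ⟨hx, hy⟩, rfl⟩
  isCompact := isCompact_Icc.image (by fun_prop)
  volume_eq_zero := by
    convert volume_image_line (t * u) (Complex.I * u) (Icc x y) using 3
    ring
  zero_notMem := by
    rintro ⟨a, -, ha⟩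
    rcases mul_eq_zero.1 ha with h | h
    · have := congrArg Complex.re h
      simp at this
      exact ht.ne' this
    · simp [h] at hu
  infDist_le := by
    refine (Metric.infDist_le_dist_of_mem (mem_image_of_mem _
      (show (0 : ℝ) ∈ Icc x y from ⟨hx, hy⟩))).trans ?_
    simp [dist_eq_norm, hu, abs_of_pos ht]

lemma isTarget_segS {t : ℝ} (ht : 0 < t) (γ' : ℝ) : IsTarget (segS γ' t) t := by
  have h0 : 0 ≤ t ^ γ' := Real.rpow_nonneg ht.le _
  have := isTarget_image ht (u := 1) (by simp) (x := -(t ^ γ') / 2) (y := 3 * t ^ γ' / 2)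
    (by linarith) (by linarith)
  simpa [segS] using this

lemma isTarget_segS' {t : ℝ} (ht : 0 < t) (γ' : ℝ) : IsTarget (segS' γ' t) t := by
  have h0 : 0 ≤ t ^ γ' := Real.rpow_nonneg ht.le _
  exact isTarget_image ht (Complex.norm_exp_ofReal_mul_I _) (by linarith) (by linarith)

lemma IsUnitPoissonProcess.ae_action_eq (hω : IsUnitPoissonProcess μ ω) {S : Set ℂ} {t s : ℝ}
    (hS : IsTarget S t) (hs : 0 < s)
    (hbdd : ∀ᵐ w ∂μ, BddBelow (chainCost S s '' {l | IsChainOf (ω w) l})) :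
    ∀ᵐ w ∂μ, BddBelow (actionValues (ω w) s 0 S) ∧
      action (ω w) s 0 S = sInf (chainCost S s '' {l | IsChainOf (ω w) l}) := by
  filter_upwards [hbdd, hω.ae_disjoint (measurableSet_singleton 0) Bornology.isBounded_singleton
    (measure_singleton (0 : ℂ)), hω.ae_disjoint hS.isCompact.measurableSet hS.isCompact.isBounded
    hS.volume_eq_zero] with w h1 h2 h3
  exact action_eq_sInf_chainCost (hω.locallyFinite w) (disjoint_singleton_left.1 h2) hS.nonempty h3
    hS.zero_notMem hs h1

end

end PoissonFPP

open PoissonFPP in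
theorem lemma4p2 {Ω : Type*} [MeasurableSpace Ω] (μ : Measure Ω) [IsProbabilityMeasure μ]
    (ω : Ω → Set ℂ) (hω : PoissonFPP.IsUnitPoissonProcess μ ω)
    (c : ℝ) (hc : 0 < c) (γ' : ℝ) (t₀ : ℝ) (ht₀ : 0 < t₀) :
    ∃ C : ℝ, ∀ t : ℝ, t₀ ≤ t →
      (∀ᵐ w ∂μ, BddBelow (PoissonFPP.actionValues (ω w) (c * t) 0 (PoissonFPP.segS γ' t)) ∧
        BddBelow (PoissonFPP.actionValues (ω w) (c * t) 0 (PoissonFPP.segS' γ' t))) ∧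
      MemLp (fun w => PoissonFPP.action (ω w) (c * t) 0 (PoissonFPP.segS γ' t) -
        PoissonFPP.action (ω w) (c * t) 0 (PoissonFPP.segS' γ' t)) 2 μ ∧
      variance (fun w => PoissonFPP.action (ω w) (c * t) 0 (PoissonFPP.segS γ' t) -
        PoissonFPP.action (ω w) (c * t) 0 (PoissonFPP.segS' γ' t)) μ ≤
          C * t ^ (2 * (2 * γ' - 1)) := by
  obtain ⟨h, hh, T, hTm, hT0, hT2, hT⟩ := hω.exists_length_le
  set K := comparisonConst c h with hK
  have hK0 : 0 ≤ K := by rw [hK, comparisonConst]; positivity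
  refine ⟨K ^ 2 * ∫ w, (1 + T w / t₀) ^ 2 ∂μ, fun t htt => ?_⟩
  have ht : 0 < t := ht₀.trans_le htt
  have hs : 0 < c * t := mul_pos hc ht
  have hS := isTarget_segS ht γ'
  have hS' := isTarget_segS' ht γ'
  have hbdd : ∀ S : Set ℂ, ∀ᵐ w ∂μ,
      BddBelow (chainCost S (c * t) '' {l | IsChainOf (ω w) l}) := fun S => by
    filter_upwards [hT] with w hw using bddBelow_chainCost hh hs fun l hl => hw l hl S
  have hA := hω.ae_action_eq hS hs (hbdd _)
  have hA' := hω.ae_action_eq hS' hs (hbdd _)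
  set X : Ω → ℝ := fun w => action (ω w) (c * t) 0 (segS γ' t) -
    action (ω w) (c * t) 0 (segS' γ' t) with hX
  set θ := angle γ' t with hθ
  have hθ0 : 0 ≤ θ := angle_nonneg ht γ'
  have hbound : ∀ᵐ w ∂μ, ‖X w‖ ≤ K * (θ ^ 2 * t) * (1 + T w / t₀) := by
    filter_upwards [hT, hA, hA'] with w hw h1 h2
    have hnil : ([] : List ℂ) ∈ {l | IsChainOf (ω w) l} := ⟨List.nodup_nil, by simp⟩
    have h3 := sInf_chainCost_le_add hnil hh (hT0 w) hc ht hw hS.nonempty hS.infDist_le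
      hS'.infDist_le hθ0 (segS_near_segS' ht γ')
    have h4 := sInf_chainCost_le_add hnil hh (hT0 w) hc ht hw hS'.nonempty hS'.infDist_le
      hS.infDist_le hθ0 (segS'_near_segS ht γ')
    have h5 : T w ≤ t * (T w / t₀) := by
      rw [mul_div_assoc', le_div_iff₀ ht₀, mul_comm]
      exact mul_le_mul_of_nonneg_right htt (hT0 w)
    have h6 : K * (θ ^ 2 * (t + T w)) ≤ K * (θ ^ 2 * t) * (1 + T w / t₀) := by
      rw [mul_assoc, mul_assoc]
      gcongr
      linarith
    rw [Real.norm_eq_abs, hX]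
    simp only [h1.2, h2.2]
    rw [abs_sub_le_iff]
    constructor <;> linarith
  have hXm : AEStronglyMeasurable X μ := by
    refine AEMeasurable.aestronglyMeasurable ?_
    refine AEMeasurable.congr ((hω.aemeasurable_sInf_chainCost (segS γ' t) hs (hbdd _)).sub
      (hω.aemeasurable_sInf_chainCost (segS' γ' t) hs (hbdd _))) ?_
    filter_upwards [hA, hA'] with w h1 h2
    simp [hX, h1.2, h2.2]
  have hY : MemLp (fun w => 1 + T w / t₀) 2 μ := by
    have := (memLp_const (1 : ℝ)).add (hT2.const_mul t₀⁻¹)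
    refine this.ae_eq (.of_forall fun w => ?_)
    simp [div_eq_inv_mul]
  have hYc := hY.const_mul (K * (θ ^ 2 * t))
  have hX2 : MemLp X 2 μ := hYc.of_le hXm (by
    filter_upwards [hbound] with w hw using hw.trans (le_abs_self _))
  refine ⟨by filter_upwards [hA, hA'] with w h1 h2 using ⟨h1.1, h2.1⟩, hX2, ?_⟩
  -- `t ϑ² = t ^ (2 γ' - 1)`
  have hD : t ^ (2 * (2 * γ' - 1)) = (θ ^ 2 * t) ^ 2 := by
    rw [hθ, angle, ← Real.rpow_natCast, ← Real.rpow_natCast, ← Real.rpow_mul ht.le]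
    nth_rewrite 3 [← Real.rpow_one t]
    rw [← Real.rpow_add ht, ← Real.rpow_mul ht.le]
    congr 1
    push_cast
    ring
  calc variance X μ ≤ ∫ w, X w ^ 2 ∂μ := variance_le_expectation_sq hXm
    _ ≤ ∫ w, (K * (θ ^ 2 * t) * (1 + T w / t₀)) ^ 2 ∂μ := by
        refine integral_mono_ae hX2.integrable_sq hYc.integrable_sq ?_
        filter_upwards [hbound] with w hw
        rw [← sq_abs]
        exact pow_le_pow_left₀ (abs_nonneg _) hw 2
    _ = K ^ 2 * (∫ w, (1 + T w / t₀) ^ 2 ∂μ) * t ^ (2 * (2 * γ' - 1)) := by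
        simp_rw [mul_pow _ (1 + T _ / t₀)]
        rw [integral_const_mul, hD]
        ring
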